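/- Graphs are finite and undirected, without multiple edges. A homomorphism is an edge-preserving vertex map. A graph $H$ is a core if every homomorphism $H\to H$ is an automorphism; a core of $H$ is an induced subgraph $C$ of $H$ that is a core and satisfies $H\to C$; and $H$ is trivial if its core has at most two vertices. The direct product $H_1\times\dots\times H_m$ has vertex set $V(H_1)\times\dots\times V(H_m)$, with $x$ and $y$ adjacent iff $x_j y_j\in E(H_j)$ for all $j$. A graph with at least two vertices is prime if, whenever it is isomorphic to $A\times B$ (where loops are allowed in $A$ and $B$), one of $A,B$ is the one-vertex graph with a loop; a prime factorization of $H$ is an isomorphism $H\cong H_1\times\dots\times H_m$ with all $H_j$ prime. The signature number $s(H)$ is the number of distinct non-empty sets of the form $\bigcap_{t\in T}N_H(t)$ with $\emptyset\ne T\subseteq V(H)$. For $H=H_1\times\dots\times H_m$, we say that $H$ is $H_i$-projective if $H_i$ is non-trivial and, for every $\ell\ge 2$, every homomorphism $f: H_1\times\dots\times H_{i-1}\times H_i^{\ell}\times H_{i+1}\times\dots\times H_m\to H_i$ such that $f(y_1,\dots,y_{i-1},x,\dots,x,y_{i+1},\dots,y_m)=x$ for all $x\in V(H_i)$ and $y_j\in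 V(H_j)$ $(j\neq i)$ is the projection onto one of the $\ell$ coordinates in $H_i$. For a fixed graph $H$, an instance of $H$-Coloring-Extension is a pair $(G',h')$ of a simple graph $G'$ and a map $h':V'\to V(H)$ with $V'\subseteq V(G')$; the question is whether there is a homomorphism $h:G'\to H$ with $h|_{V'}=h'$. Let $\operatorname{cw}(G')$ denote the clique-width of $G'$. Algorithms are deterministic random access machine programs, and running times are at logarithmic cost; $\mathcal O^*(\cdot)$ suppresses factors polynomial in the input size (the number of vertices of $G'$, or the number of variables plus the number of clauses of a formula). The Strong Exponential Time Hypothesis (SETH) states that for every $\delta<1$ there is a $k$ such that $k$-SAT with $n$ variables cannot be solved in time $\mathcal O^*(2^{\delta n})$. **Theorem.** Let $H$ be a fixed non-trivial core with prime factorization $H_1\times\dots\times H_m$, and assume that $H$ is $H_i$-projective for some $i\in\{1,\dots,m\}$. Then, for every $\varepsilon>0$, there is no algorithm that solves $H$-Coloring-Extension in time $\mathcal O^*\big((s(H_i)-\varepsilon)^{\operatorname{cw}(G')}\big)$, unless the SETH fails. -/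

import Mathlib

/-! ### Graphs that may have loops, homomorphisms, cores -/

/-- An undirected graph without multiple edges that may have loops. -/
@[ext]
structure LoopGraph (V : Type) where
  /-- adjacency; `Adj v v` means that `v` carries a loop -/
  Adj : V → V → Prop
  symm : ∀ u v, Adj u v → Adj v u

namespace LoopGraph

/-- Homomorphisms: edge-preserving maps of the vertices. -/
abbrev Hom {V W : Type} (G : LoopGraph V) (H : LoopGraph W) : Type := G.Adj →r H.Adj

/-- Isomorphisms: bijections of the vertices that preserve and reflect edges. -/
abbrev Iso {V W : Type} (G : LoopGraph V) (H : LoopGraph W) : Type := G.Adj ≃r H.Adj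

/-- The subgraph induced on a set of vertices. -/
def induce {V : Type} (H : LoopGraph V) (C : Set V) : LoopGraph C where
  Adj u v := H.Adj u v
  symm u v h := H.symm u v h

/-- A graph is a core if each of its endomorphisms is an automorphism. -/
def IsCore {V : Type} (H : LoopGraph V) : Prop :=
  ∀ f : Hom H H, ∃ g : Iso H H, ∀ v, g v = f v

/-- The subgraph induced on `C` is a core of `H`. -/
def IsCoreOf {V : Type} (C : Set V) (H : LoopGraph V) : Prop :=
  (H.induce C).IsCore ∧ Nonempty (Hom H (H.induce C))

/-- A graph is trivial if its core has at most two vertices. -/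
def IsTrivial {V : Type} (H : LoopGraph V) : Prop :=
  ∃ C : Set V, IsCoreOf C H ∧ C.Finite ∧ C.ncard ≤ 2

/-! ### Signature number -/

/-- The common neighbourhood of a set of vertices. -/
def commonNbrs {V : Type} (H : LoopGraph V) (T : Set V) : Set V :=
  {v | ∀ t ∈ T, H.Adj t v}

/-- The signature sets: the non-empty common neighbourhoods of the non-empty vertex sets. -/
def signatureSets {V : Type} (H : LoopGraph V) : Set (Set V) :=
  {S | S.Nonempty ∧ ∃ T : Set V, T.Nonempty ∧ S = H.commonNbrs T}

/-- The signature number `s(H)`, the number of signature sets. -/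
noncomputable def signatureNumber {V : Type} (H : LoopGraph V) : ℕ :=
  H.signatureSets.ncard

/-! ### Direct products, prime graphs, projectivity with respect to a factor -/

/-- The direct product of two graphs. -/
def prod {V W : Type} (G : LoopGraph V) (H : LoopGraph W) : LoopGraph (V × W) where
  Adj x y := G.Adj x.1 y.1 ∧ H.Adj x.2 y.2
  symm _ _ h := ⟨G.symm _ _ h.1, H.symm _ _ h.2⟩

/-- The direct product of a family of graphs. -/
def pi {ι : Type} {V : ι → Type} (H : ∀ j, LoopGraph (V j)) : LoopGraph (∀ j, V j) where
  Adj x y := ∀ j, (H j).Adj (x j) (y j)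
  symm _ _ h j := (H j).symm _ _ (h j)

/-- The direct power `H ^ ℓ`. -/
def power {V : Type} (H : LoopGraph V) (ℓ : ℕ) : LoopGraph (Fin ℓ → V) :=
  pi fun _ => H

/-- The graph consists of one vertex with a loop. -/
def IsOneLoop {V : Type} (H : LoopGraph V) : Prop :=
  ∃ v, H.Adj v v ∧ ∀ u, u = v

/-- A graph on at least two vertices is prime if it is a direct product of two graphs (possibly
with loops) only when one of them is the one-vertex graph with a loop. -/
def IsPrime {V : Type} (H : LoopGraph V) : Prop :=
  Nontrivial V ∧ ∀ (A B : Type) (G₁ : LoopGraph A) (G₂ : LoopGraph B),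
    Nonempty (Iso H (G₁.prod G₂)) → G₁.IsOneLoop ∨ G₂.IsOneLoop

/-- The graphs `H₁, …, Hₘ` form a prime factorization of `H`. -/
def IsPrimeFactorization {V : Type} (H : LoopGraph V) {m : ℕ} {U : Fin m → Type}
    (F : ∀ j, LoopGraph (U j)) : Prop :=
  Nonempty (Iso H (pi F)) ∧ ∀ j, (F j).IsPrime

/-- The direct product `Hᵢ ^ ℓ × ∏_{j ≠ i} Hⱼ`, in which the factor `Hᵢ` of `H₁ × … × Hₘ` is
replaced by its `ℓ`-th power. (For `m = 1` the second factor is one vertex with a loop.) -/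
def powerAt {m : ℕ} {U : Fin m → Type} (F : ∀ j, LoopGraph (U j)) (i : Fin m) (ℓ : ℕ) :
    LoopGraph ((Fin ℓ → U i) × (∀ j : {j : Fin m // j ≠ i}, U j)) :=
  ((F i).power ℓ).prod (pi fun j : {j : Fin m // j ≠ i} => F j)

/-- `H₁ × … × Hₘ` is `Hᵢ`-projective: `Hᵢ` is non-trivial, and each `Hᵢ`-idempotent homomorphism
`Hᵢ ^ ℓ × ∏_{j ≠ i} Hⱼ → Hᵢ` is the projection to one of the `ℓ` coordinates in `Hᵢ`. -/
def IsProjectiveAt {m : ℕ} {U : Fin m → Type} (F : ∀ j, LoopGraph (U j)) (i : Fin m) : Prop :=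
  ¬ (F i).IsTrivial ∧
    ∀ ℓ : ℕ, 2 ≤ ℓ → ∀ f : Hom (powerAt F i ℓ) (F i),
      (∀ (x : U i) (y : ∀ j : {j : Fin m // j ≠ i}, U j), f (fun _ => x, y) = x) →
        ∃ q : Fin ℓ, ∀ z, f z = z.1 q

end LoopGraph

/-! ### Clique-width -/

/-- `KGraph k G lab`: the graph `G` with the labelling `lab` of its vertices by `k` labels is the
evaluation of a `k`-expression. -/
inductive KGraph (k : ℕ) : {V : Type} → SimpleGraph V → (V → Fin k) → Prop
  /-- one vertex, labelled `i` -/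
  | single (i : Fin k) : KGraph k (⊥ : SimpleGraph Unit) fun _ => i
  /-- disjoint union -/
  | union {V W : Type} {G₁ : SimpleGraph V} {G₂ : SimpleGraph W} {l₁ : V → Fin k}
      {l₂ : W → Fin k} (h₁ : KGraph k G₁ l₁) (h₂ : KGraph k G₂ l₂) :
      KGraph k (SimpleGraph.sum G₁ G₂) (Sum.elim l₁ l₂)
  /-- changing all labels `i` to `j` -/
  | relabel {V : Type} {G : SimpleGraph V} {l : V → Fin k} (i j : Fin k) (h : KGraph k G l) :
      KGraph k G fun v => if l v = i then j else l v
  /-- adding all edges between the vertices labelled `i` and the vertices labelled `j` -/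
  | join {V : Type} {G : SimpleGraph V} {l : V → Fin k} (i j : Fin k) (hij : i ≠ j)
      (h : KGraph k G l) :
      KGraph k (G ⊔ SimpleGraph.fromRel fun u v => l u = i ∧ l v = j) l

/-- The clique-width of a finite graph: the least `k` such that a `k`-expression defines the graph
up to isomorphism (and `0` for the graph without vertices, which no expression defines). -/
noncomputable def cliqueWidth {V : Type} (G : SimpleGraph V) : ℕ :=
  sInf {k | ∃ (W : Type) (G' : SimpleGraph W) (l : W → Fin k),
    KGraph k G' l ∧ Nonempty (G' ≃g G)}

/-! ### Random access machines with logarithmic cost -/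

/-- Programs of a random access machine in structured form. There are registers, and arrays with
indirect addressing; a program mentions finitely many of both. All contents are natural numbers. -/
inductive RamProg : Type
  | skip : RamProg
  /-- `reg r := c` -/
  | const (r c : ℕ) : RamProg
  /-- `reg r := reg s + reg t` -/
  | add (r s t : ℕ) : RamProg
  /-- `reg r := max (reg s - reg t) 0` -/
  | sub (r s t : ℕ) : RamProg
  /-- `reg r := mem a [reg s]` -/
  | load (r a s : ℕ) : RamProg
  /-- `mem a [reg r] := reg s` -/
  | store (a r s : ℕ) : RamProg
  | seq (p q : RamProg) : RamProg
  /-- if `reg r ≠ 0` then `p` else `q` -/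
  | ite (r : ℕ) (p q : RamProg) : RamProg
  /-- while `reg r ≠ 0` do `p` -/
  | loop (r : ℕ) (p : RamProg) : RamProg

/-- The contents of the registers and of the arrays. -/
structure RamState where
  reg : ℕ → ℕ
  mem : ℕ → ℕ → ℕ

namespace RamState

/-- Overwrite register `r`. -/
def setReg (σ : RamState) (r v : ℕ) : RamState :=
  { σ with reg := Function.update σ.reg r v }

/-- Overwrite cell `x` of array `a`. -/
def setMem (σ : RamState) (a x v : ℕ) : RamState :=
  { σ with mem := Function.update σ.mem a (Function.update (σ.mem a) x v) }

/-- The initial state: the input stands in array `0`, its length in register `0`, and everything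
else is `0`. -/
def init (w : List ℕ) : RamState where
  reg r := if r = 0 then w.length else 0
  mem a x := if a = 0 then w.getD x 0 else 0

end RamState

/-- `RamProg.Run p σ t σ'`: started in state `σ`, the program `p` halts in state `σ'` after time
`t`. Each instruction and each test takes time one plus the number of bits of its operands and
addresses (`Nat.size`). -/
inductive RamProg.Run : RamProg → RamState → ℕ → RamState → Prop
  | skip (σ : RamState) : Run RamProg.skip σ 1 σ
  | const (σ : RamState) (r c : ℕ) :
      Run (RamProg.const r c) σ (1 + c.size) (σ.setReg r c)
  | add (σ : RamState) (r s t : ℕ) :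
      Run (RamProg.add r s t) σ (1 + (σ.reg s).size + (σ.reg t).size)
        (σ.setReg r (σ.reg s + σ.reg t))
  | sub (σ : RamState) (r s t : ℕ) :
      Run (RamProg.sub r s t) σ (1 + (σ.reg s).size + (σ.reg t).size)
        (σ.setReg r (σ.reg s - σ.reg t))
  | load (σ : RamState) (r a s : ℕ) :
      Run (RamProg.load r a s) σ (1 + (σ.reg s).size + (σ.mem a (σ.reg s)).size)
        (σ.setReg r (σ.mem a (σ.reg s)))
  | store (σ : RamState) (a r s : ℕ) :
      Run (RamProg.store a r s) σ (1 + (σ.reg r).size + (σ.reg s).size)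
        (σ.setMem a (σ.reg r) (σ.reg s))
  | seq (p q : RamProg) (σ σ₁ σ₂ : RamState) (t₁ t₂ : ℕ) (h₁ : Run p σ t₁ σ₁)
      (h₂ : Run q σ₁ t₂ σ₂) : Run (RamProg.seq p q) σ (t₁ + t₂) σ₂
  | ite_true (r : ℕ) (p q : RamProg) (σ σ₁ : RamState) (t : ℕ) (h : σ.reg r ≠ 0)
      (h₁ : Run p σ t σ₁) : Run (RamProg.ite r p q) σ (1 + (σ.reg r).size + t) σ₁
  | ite_false (r : ℕ) (p q : RamProg) (σ σ₁ : RamState) (t : ℕ) (h : σ.reg r = 0)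
      (h₁ : Run q σ t σ₁) : Run (RamProg.ite r p q) σ (1 + (σ.reg r).size + t) σ₁
  | loop_done (r : ℕ) (p : RamProg) (σ : RamState) (h : σ.reg r = 0) :
      Run (RamProg.loop r p) σ 1 σ
  | loop_step (r : ℕ) (p : RamProg) (σ σ₁ σ₂ : RamState) (t₁ t₂ : ℕ) (h : σ.reg r ≠ 0)
      (h₁ : Run p σ t₁ σ₁) (h₂ : Run (RamProg.loop r p) σ₁ t₂ σ₂) :
      Run (RamProg.loop r p) σ (1 + (σ.reg r).size + t₁ + t₂) σ₂

/-! ### Parameterized decision problems and their running times -/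

/-- A decision problem with a parameter: instances with their encoding as input for a machine,
their size, their parameter, and the set of yes-instances. -/
structure ParamProblem where
  Inst : Type
  encode : Inst → List ℕ
  size : Inst → ℕ
  param : Inst → ℕ
  IsYes : Inst → Prop

/-- The problem can be solved in time `O*(T(k))` where `k` is the parameter: there are a program
and a polynomial `p` such that the program halts on each instance after time at most `T(k)` times
`p(size)`, with register `0` being non-zero exactly on the yes-instances. -/
def ParamProblem.SolvableInTime (P : ParamProblem) (T : ℕ → ℝ) : Prop :=
  ∃ (prog : RamProg) (p : Polynomial ℕ), ∀ x : P.Inst, ∃ (t : ℕ) (σ : RamState),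
    prog.Run (RamState.init (P.encode x)) t σ ∧
    (t : ℝ) ≤ T (P.param x) * (p.eval (P.size x) : ℕ) ∧
    (σ.reg 0 ≠ 0 ↔ P.IsYes x)

/-! ### `k`-SAT and the Strong Exponential Time Hypothesis -/

/-- A formula in conjunctive normal form with `n` variables and `k` literals in each clause
(repetitions are allowed, so that shorter non-empty clauses are included). The literal `(v, true)`
is the variable `v`, and `(v, false)` is its negation. -/
structure KCnf (k : ℕ) where
  n : ℕ
  clauses : List (Fin k → Fin n × Bool)

/-- Some truth assignment satisfies a literal in each clause. -/
def KCnf.Satisfiable {k : ℕ} (φ : KCnf k) : Prop :=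
  ∃ a : Fin φ.n → Bool, ∀ c ∈ φ.clauses, ∃ j, a (c j).1 = (c j).2

/-- The number of variables, the number of clauses, and the literals clause by clause, a literal
`(v, b)` being written as `2 v + b`. -/
def KCnf.encode {k : ℕ} (φ : KCnf k) : List ℕ :=
  φ.n :: φ.clauses.length ::
    φ.clauses.flatMap fun c => List.ofFn fun j => 2 * ((c j).1 : ℕ) + (c j).2.toNat

/-- `k`-SAT, parameterized by the number of variables. -/
def kSat (k : ℕ) : ParamProblem where
  Inst := KCnf k
  encode φ := φ.encode
  size φ := φ.n + φ.clauses.length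
  param φ := φ.n
  IsYes φ := φ.Satisfiable

/-- The Strong Exponential Time Hypothesis: for each `δ < 1` there is `k` such that `k`-SAT with
`n` variables cannot be solved in time `O*(2 ^ (δ n))`. -/
def SETH : Prop :=
  ∀ δ : ℝ, δ < 1 → ∃ k : ℕ, ¬ (kSat k).SolvableInTime fun n => (2 : ℝ) ^ (δ * n)

/-! ### The homomorphism extension problem -/

/-- An instance: a finite simple graph and a partial map from its vertices to `V`. -/
structure ExtInstance (V : Type) where
  n : ℕ
  G : SimpleGraph (Fin n)
  h : Fin n → Option V

/-- There is a homomorphism from the graph to `H` that extends the partial map. -/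
def ExtInstance.HasExtension {V : Type} (H : LoopGraph V) (x : ExtInstance V) : Prop :=
  ∃ f : x.G.Adj →r H.Adj, ∀ u v, x.h u = some v → f u = v

open Classical in
/-- The number of vertices, the adjacency matrix row by row, and for each vertex `0` if the
partial map is undefined and `1` plus the number of the image otherwise. The vertices of the fixed
target are numbered by `num`. -/
noncomputable def ExtInstance.encode {V : Type} {N : ℕ} (num : V ≃ Fin N) (x : ExtInstance V) :
    List ℕ :=
  x.n ::
    (((List.finRange x.n).flatMap fun u => (List.finRange x.n).map fun v =>
        if x.G.Adj u v then 1 else 0) ++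
      (List.finRange x.n).map fun u => (x.h u).elim 0 fun v => (num v : ℕ) + 1)

/-- `H`-Coloring-Extension, parameterized by the clique-width of the input graph. -/
noncomputable def hColoringExtension {V : Type} {N : ℕ} (H : LoopGraph V) (num : V ≃ Fin N) :
    ParamProblem where
  Inst := ExtInstance V
  encode x := x.encode num
  size x := x.n
  param x := cliqueWidth x.G
  IsYes x := x.HasExtension H

/-! ### A calculus for programs of the machine -/

namespace RamState

/-! Write H ≅ P × W with P = H_i, and let s be the signature number of P. A solver with base β < s
would decide k-SAT too fast for every k. Choose p and τ with β^p < 2^τ ≤ s^p (`exists_block_size`),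
cut the variables into blocks of τ, and encode an assignment of a block by a p-tuple of signature
sets of P.

The gadget of a clause (`ProjectiveWith.exists_gadget`) is a blow-up of P^Q × W, where Q consists of
all claims about the clause: assignments for the blocks of its k slots, and a slot said to be
satisfied. Vertices over constant vectors are pinned to their value, so by projectivity a colouring
selects one coordinate q in Q, that is, one claim; check vertices exclude false claims. A claimed
signature set is exhibited twice: by readers, whose colours (in P) are its elements, and by writers,
whose colours have it as common neighbourhood. Joining the readers of one copy to the writers of an
earlier copy forces the later set to lie inside the earlier one.

This gives containment only, not equality. Therefore the list of clauses is repeated for more rounds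
than sets can shrink in total. In some round nothing shrinks, so all occurrences of a block agree
there, and a satisfying assignment can be read off (`Implements.exists_hom_iff`).

The copies are added one after another. What later copies see of an old vertex is only the block and
the index of the signature set that it writes, so about p·n/τ labels suffice, plus a number
independent of the formula (`cliqueWidth_inst_le`). Hence β^cw is at most a constant times 2^(δn),
where 2^(δτ) = β^p and δ < 1, contrary to SETH.

The machine model needs an explicit program that writes the instance in polynomial time
(`wp_reduction`), after which the solver runs in fresh registers and arrays (`Run.shift`). -/

theorem reg_setReg (σ : RamState) (r v s : ℕ) :
    (σ.setReg r v).reg s = if s = r then v else σ.reg s := by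
  simp [setReg, Function.update_apply]

theorem mem_setReg (σ : RamState) (r v : ℕ) : (σ.setReg r v).mem = σ.mem := rfl

theorem reg_setMem (σ : RamState) (a x v : ℕ) : (σ.setMem a x v).reg = σ.reg := rfl

theorem mem_setMem (σ : RamState) (a x v b y : ℕ) :
    (σ.setMem a x v).mem b y = if b = a ∧ y = x then v else σ.mem b y := by
  by_cases hb : b = a
  · subst hb; by_cases hy : y = x <;> simp [setMem, hy]
  · simp [setMem, hb]

/-- All numbers in the registers and arrays have at most `b` bits. -/
def Bdd (σ : RamState) (b : ℕ) : Prop :=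
  (∀ r, (σ.reg r).size ≤ b) ∧ ∀ a x, (σ.mem a x).size ≤ b

theorem Bdd.mono {σ : RamState} {b c : ℕ} (h : σ.Bdd b) (hbc : b ≤ c) : σ.Bdd c :=
  ⟨fun r => (h.1 r).trans hbc, fun a x => (h.2 a x).trans hbc⟩

theorem Bdd.setReg {σ : RamState} {b r v : ℕ} (h : σ.Bdd b) (hv : v.size ≤ b) :
    (σ.setReg r v).Bdd b := by
  refine ⟨fun s => ?_, h.2⟩
  rw [reg_setReg]; split_ifs
  exacts [hv, h.1 s]

theorem Bdd.setMem {σ : RamState} {b a x v : ℕ} (h : σ.Bdd b) (hv : v.size ≤ b) :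
    (σ.setMem a x v).Bdd b := by
  refine ⟨h.1, fun c y => ?_⟩
  rw [mem_setMem]; split_ifs
  exacts [hv, h.2 c y]

end RamState

theorem Nat.size_add_le {x y b : ℕ} (hx : x.size ≤ b) (hy : y.size ≤ b) :
    (x + y).size ≤ b + 1 := by
  rw [Nat.size_le] at *
  rw [pow_succ]; lia

namespace RamProg

/-- Started in `σ`, the program halts in a state satisfying `Q`; the number `n` bounds the number
of steps, so that logarithmic cost and growth of the numbers are controlled by `n`. -/
def Wp (p : RamProg) (σ : RamState) (n : ℕ) (Q : RamState → Prop) : Prop :=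
  ∀ b, σ.Bdd b → ∃ t σ', p.Run σ t σ' ∧ Q σ' ∧ σ'.Bdd (b + n) ∧ t ≤ n * (1 + 2 * (b + n))

variable {p q : RamProg} {σ : RamState} {m n r s a c : ℕ} {Q Q' : RamState → Prop}

theorem Wp.mono (h : p.Wp σ m Q) (hmn : m ≤ n) (hQ : ∀ σ', Q σ' → Q' σ') : p.Wp σ n Q' := by
  intro b hb
  obtain ⟨t, σ', h₁, h₂, h₃, h₄⟩ := h b hb
  exact ⟨t, σ', h₁, hQ _ h₂, h₃.mono (by lia), h₄.trans (by gcongr)⟩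

theorem Wp.skip (h : Q σ) : RamProg.skip.Wp σ 1 Q := fun b hb =>
  ⟨1, σ, .skip σ, h, hb.mono (by lia), by lia⟩

theorem Wp.const (h : Q (σ.setReg r c)) : (RamProg.const r c).Wp σ (1 + c.size) Q := fun b hb =>
  ⟨_, _, .const σ r c, h, (hb.mono (by lia)).setReg (by lia), by nlinarith⟩

theorem Wp.add (h : Q (σ.setReg r (σ.reg s + σ.reg a))) : (RamProg.add r s a).Wp σ 1 Q :=
  fun b hb => ⟨_, _, .add σ r s a, h,
    (hb.mono (by lia)).setReg (Nat.size_add_le (hb.1 s) (hb.1 a)), by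
      have := hb.1 s; have := hb.1 a; lia⟩

theorem Wp.sub (h : Q (σ.setReg r (σ.reg s - σ.reg a))) : (RamProg.sub r s a).Wp σ 1 Q :=
  fun b hb => ⟨_, _, .sub σ r s a, h,
    (hb.mono (by lia)).setReg ((Nat.size_le_size (Nat.sub_le _ _)).trans
      ((hb.1 s).trans (by lia))), by
      have := hb.1 s; have := hb.1 a; lia⟩

theorem Wp.load (h : Q (σ.setReg r (σ.mem a (σ.reg s)))) : (RamProg.load r a s).Wp σ 1 Q :=
  fun b hb => ⟨_, _, .load σ r a s, h,
    (hb.mono (by lia)).setReg ((hb.2 _ _).trans (by lia)), by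
      have := hb.1 s; have := hb.2 a (σ.reg s); lia⟩

theorem Wp.store (h : Q (σ.setMem a (σ.reg r) (σ.reg s))) : (RamProg.store a r s).Wp σ 1 Q :=
  fun b hb => ⟨_, _, .store σ a r s, h,
    (hb.mono (by lia)).setMem ((hb.1 _).trans (by lia)), by
      have := hb.1 s; have := hb.1 r; lia⟩

/-- Numbers gain at most one bit per counted step, so the second program starts from the bound `b +
m`; both costs are then charged at the rate for the final bound `b + (m + n)`. -/
theorem Wp.seq (h : p.Wp σ m fun σ' => q.Wp σ' n Q) : (RamProg.seq p q).Wp σ (m + n) Q := by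
  intro b hb
  obtain ⟨t, σ₁, h₁, h₂, h₃, h₄⟩ := h b hb
  obtain ⟨t', σ₂, h₁', h₂', h₃', h₄'⟩ := h₂ _ h₃
  refine ⟨_, _, .seq _ _ _ _ _ _ _ h₁ h₁', h₂', h₃'.mono (by lia), ?_⟩
  calc t + t' ≤ m * (1 + 2 * (b + (m + n))) + n * (1 + 2 * (b + (m + n))) :=
        add_le_add (h₄.trans (by gcongr; lia)) (h₄'.trans (by gcongr 1; lia))
    _ = _ := by ring

theorem Wp.ite (h₁ : σ.reg r ≠ 0 → p.Wp σ n Q) (h₂ : σ.reg r = 0 → q.Wp σ n Q) :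
    (RamProg.ite r p q).Wp σ (n + 1) Q := by
  intro b hb
  have hr := hb.1 r
  by_cases h : σ.reg r = 0
  · obtain ⟨t, σ₁, h₁, h₂, h₃, h₄⟩ := h₂ h b hb
    exact ⟨_, _, .ite_false _ _ _ _ _ _ h h₁, h₂, h₃.mono (by lia), by nlinarith⟩
  · obtain ⟨t, σ₁, h₁, h₂, h₃, h₄⟩ := h₁ h b hb
    exact ⟨_, _, .ite_true _ _ _ _ _ _ h h₁, h₂, h₃.mono (by lia), by nlinarith⟩

/-- The invariant is indexed by the iteration and thereby fixes the number `m` of iterations. Each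
iteration pays `n` for the body and one for the test; the final failing test pays one more. -/
theorem Wp.loop (I : ℕ → RamState → Prop) (hne : ∀ i < m, ∀ σ, I i σ → σ.reg r ≠ 0)
    (hz : ∀ σ, I m σ → σ.reg r = 0) (hb : ∀ i < m, ∀ σ, I i σ → p.Wp σ n (I (i + 1)))
    (hσ : I 0 σ) : (RamProg.loop r p).Wp σ (m * (n + 1) + 1) (I m) := by
  suffices h : ∀ d i σ, i + d = m → I i σ → (RamProg.loop r p).Wp σ (d * (n + 1) + 1) (I m) from
    h m 0 σ (by lia) hσ
  intro d
  induction d with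
  | zero =>
    intro i σ hi hI b hbd
    obtain rfl : i = m := by lia
    exact ⟨_, _, .loop_done _ _ _ (hz _ hI), hI, hbd.mono (by lia), by lia⟩
  | succ d ih =>
    intro i σ hi hI b hbd
    obtain ⟨t, σ₁, h₁, h₂, h₃, h₄⟩ := hb i (by lia) σ hI b hbd
    obtain ⟨t', σ₂, h₁', h₂', h₃', h₄'⟩ := ih (i + 1) σ₁ (by lia) h₂ _ h₃
    refine ⟨_, _, .loop_step _ _ _ _ _ _ _ (hne i (by lia) σ hI) h₁ h₁', h₂',
      h₃'.mono (by lia), ?_⟩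
    have hr := hbd.1 r
    set B := b + ((d + 1) * (n + 1) + 1) with hB
    have e₁ : b + n ≤ B := by rw [hB]; nlinarith
    have e₂ : b + n + (d * (n + 1) + 1) ≤ B := by rw [hB]; nlinarith
    have e₃ : t ≤ n * (1 + 2 * B) := h₄.trans (by gcongr)
    have e₄ : t' ≤ (d * (n + 1) + 1) * (1 + 2 * B) := h₄'.trans (by gcongr)
    have e₅ : b ≤ B := by lia
    nlinarith

/-- Sequential composition of a list of programs. -/
def seqList : List RamProg → RamProg
  | [] => .skip
  | p :: ps => .seq p (seqList ps)

/-- A loop unrolled in the program text, for ranges of constant length such as the slots of a clause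
or the vertices of one gadget. The final `+ 1` is the closing `skip`. -/
theorem Wp.seqList {α : Type} {f : α → RamProg} {xs : List α} (I : List α → RamState → Prop)
    (h : ∀ pre x σ, I pre σ → (f x).Wp σ n (I (pre ++ [x]))) (hσ : I [] σ) :
    (RamProg.seqList (xs.map f)).Wp σ (xs.length * n + 1) (I xs) := by
  suffices H : ∀ xs pre σ, I pre σ →
      (RamProg.seqList (xs.map f)).Wp σ (xs.length * n + 1) (I (pre ++ xs)) from H xs [] σ hσ
  intro xs
  induction xs with
  | nil => intro pre σ hI; simpa [RamProg.seqList] using Wp.skip hI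
  | cons x xs ih =>
    intro pre σ hI
    refine (Wp.seq ((h pre x σ hI).mono le_rfl fun σ' h' => ih _ σ' h')).mono ?_ ?_
    · simp; lia
    · simp

/-- Rename the registers and the arrays of a program by adding `d` and `e`. -/
def shift (d e : ℕ) : RamProg → RamProg
  | .skip => .skip
  | .const r c => .const (d + r) c
  | .add r s t => .add (d + r) (d + s) (d + t)
  | .sub r s t => .sub (d + r) (d + s) (d + t)
  | .load r a s => .load (d + r) (e + a) (d + s)
  | .store a r s => .store (e + a) (d + r) (d + s)
  | .seq p q => .seq (shift d e p) (shift d e q)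
  | .ite r p q => .ite (d + r) (shift d e p) (shift d e q)
  | .loop r p => .loop (d + r) (shift d e p)

/-- The state `ρ` contains `σ`, renamed by adding `d` and `e`. -/
def _root_.RamState.Contains (d e : ℕ) (ρ σ : RamState) : Prop :=
  (∀ r, ρ.reg (d + r) = σ.reg r) ∧ ∀ a x, ρ.mem (e + a) x = σ.mem a x

/-- Logarithmic cost charges contents and computed addresses, not the names of registers and arrays,
so renaming leaves the time unchanged. It lets the given solver run in a region that looks like its
initial state. -/
theorem Run.shift {d e t : ℕ} {σ' : RamState} (h : p.Run σ t σ') :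
    ∀ ρ : RamState, ρ.Contains d e σ → ∃ ρ' : RamState, (p.shift d e).Run ρ t ρ' ∧ ρ'.Contains d e σ' := by
  have hreg : ∀ (ρ σ : RamState) (r v : ℕ), ρ.Contains d e σ →
      (ρ.setReg (d + r) v).Contains d e (σ.setReg r v) := fun ρ σ r v h =>
    ⟨fun s => by simp [RamState.reg_setReg, h.1 s], h.2⟩
  induction h with
  | skip σ => exact fun ρ hρ => ⟨ρ, .skip _, hρ⟩
  | const σ r c => exact fun ρ hρ => ⟨_, .const _ _ _, hreg _ _ _ _ hρ⟩
  | add σ r s t =>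
    intro ρ hρ
    have := Run.add ρ (d + r) (d + s) (d + t)
    rw [hρ.1, hρ.1] at this
    exact ⟨_, this, hreg _ _ _ _ hρ⟩
  | sub σ r s t =>
    intro ρ hρ
    have := Run.sub ρ (d + r) (d + s) (d + t)
    rw [hρ.1, hρ.1] at this
    exact ⟨_, this, hreg _ _ _ _ hρ⟩
  | load σ r a s =>
    intro ρ hρ
    have := Run.load ρ (d + r) (e + a) (d + s)
    rw [hρ.1, hρ.2] at this
    exact ⟨_, this, hreg _ _ _ _ hρ⟩
  | store σ a r s =>
    intro ρ hρ
    have := Run.store ρ (e + a) (d + r) (d + s)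
    rw [hρ.1, hρ.1] at this
    exact ⟨_, this, hρ.1, fun c y => by simp [RamState.mem_setMem, hρ.2 c y]⟩
  | seq p q σ σ₁ σ₂ t₁ t₂ h₁ h₂ ih₁ ih₂ =>
    intro ρ hρ
    obtain ⟨ρ₁, h₁, hρ₁⟩ := ih₁ ρ hρ
    obtain ⟨ρ₂, h₂, hρ₂⟩ := ih₂ ρ₁ hρ₁
    exact ⟨ρ₂, .seq _ _ _ _ _ _ _ h₁ h₂, hρ₂⟩
  | ite_true r p q σ σ₁ t h h₁ ih =>
    intro ρ hρ
    obtain ⟨ρ₁, h₁, hρ₁⟩ := ih ρ hρ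
    have := Run.ite_true (d + r) (p.shift d e) (q.shift d e) ρ ρ₁ t (by rwa [hρ.1]) h₁
    rw [hρ.1] at this
    exact ⟨ρ₁, this, hρ₁⟩
  | ite_false r p q σ σ₁ t h h₁ ih =>
    intro ρ hρ
    obtain ⟨ρ₁, h₁, hρ₁⟩ := ih ρ hρ
    have := Run.ite_false (d + r) (p.shift d e) (q.shift d e) ρ ρ₁ t (by rwa [hρ.1]) h₁
    rw [hρ.1] at this
    exact ⟨ρ₁, this, hρ₁⟩
  | loop_done r p σ h =>
    exact fun ρ hρ => ⟨ρ, .loop_done _ _ _ (by rwa [hρ.1]), hρ⟩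
  | loop_step r p σ σ₁ σ₂ t₁ t₂ h h₁ h₂ ih₁ ih₂ =>
    intro ρ hρ
    obtain ⟨ρ₁, h₁, hρ₁⟩ := ih₁ ρ hρ
    obtain ⟨ρ₂, h₂, hρ₂⟩ := ih₂ ρ₁ hρ₁
    have := Run.loop_step (d + r) (p.shift d e) ρ ρ₁ ρ₂ t₁ t₂ (by rwa [hρ.1]) h₁ h₂
    rw [hρ.1] at this
    exact ⟨ρ₂, this, hρ₂⟩

end RamProg

/-! ### The program that writes down an instance made of copies of a gadget -/

/-- The data of a gadget that the reduction program needs: its adjacency matrix, for each pair of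
vertices of different copies the pair of slots that decides on their adjacency, and for each vertex
the slot and type under which it is pinned, and the code of its image. -/
structure GadgetCode (k g : ℕ) where
  adj : Fin g → Fin g → ℕ
  link : Fin g → Fin g → Option (Fin k × Fin k)
  cond : Fin g → Option (Fin k × ℕ)
  val : Fin g → ℕ

namespace GadgetCode

variable {k g : ℕ} (γ : GadgetCode k g) (blk ty : ℕ → ℕ → ℕ)

/-- The entry for a vertex of copy `t` and a vertex of an earlier copy `t'`. -/
def cross (x : Option (Fin k × Fin k)) (t t' : ℕ) : ℕ :=
  x.elim 0 fun l => if blk l.1 t = blk l.2 t' then 1 else 0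

/-- The entry of the adjacency matrix for vertex `j` of copy `t` and vertex `j'` of copy `t'`. -/
def bit (t : ℕ) (j : Fin g) (t' : ℕ) (j' : Fin g) : ℕ :=
  if t' < t then cross blk (γ.link j j') t t'
  else if t < t' then cross blk (γ.link j' j) t' t else γ.adj j j'

/-- The code of the image of vertex `j` of copy `t`. -/
def pin (t : ℕ) (j : Fin g) : ℕ :=
  (γ.cond j).elim (γ.val j) fun c => if ty c.1 t = c.2 then γ.val j else 0

/-- The numbers in the gadget have at most `M` bits. -/
def Bdd (M : ℕ) : Prop :=
  1 ≤ M ∧ (∀ j j', (γ.adj j j').size ≤ M) ∧ (∀ j, (γ.val j).size ≤ M) ∧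
    ∀ j, ∀ c ∈ γ.cond j, c.2.size ≤ M

theorem exists_bdd : ∃ M, γ.Bdd M := by
  refine ⟨1 + (∑ j, ∑ j', (γ.adj j j').size) + (∑ j, (γ.val j).size) +
    ∑ j, (γ.cond j).elim 0 fun c => c.2.size, by lia, fun j j' => ?_, fun j => ?_, fun j c hc => ?_⟩
  · have h₁ := Finset.single_le_sum (f := fun j => ∑ j', (γ.adj j j').size)
      (fun _ _ => Nat.zero_le _) (Finset.mem_univ j)
    have h₂ := Finset.single_le_sum (f := fun j' => (γ.adj j j').size)
      (fun _ _ => Nat.zero_le _) (Finset.mem_univ j')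
    lia
  · have h₁ := Finset.single_le_sum (f := fun j => (γ.val j).size)
      (fun _ _ => Nat.zero_le _) (Finset.mem_univ j)
    lia
  · have h₁ := Finset.single_le_sum (f := fun j => (γ.cond j).elim 0 fun c => c.2.size)
      (fun _ _ => Nat.zero_le _) (Finset.mem_univ j)
    simp only [Option.mem_def] at h₁ hc
    rw [hc] at h₁
    simp only [Option.elim_some] at h₁
    lia

/-- The invariant of the output phase: the tables are in place, and `w` has been written. -/
structure Core (k L : ℕ) (blk ty : ℕ → ℕ → ℕ) (w : List ℕ) (σ : RamState) : Prop where
  one : σ.reg 1 = 1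
  len : σ.reg 5 = L
  out : ∀ r, σ.reg (16 + r) = if r = 0 then w.length else 0
  blk : ∀ l < k, ∀ x < L, σ.mem (1 + l) x = blk l x
  ty : ∀ l < k, ∀ x < L, σ.mem (1 + k + l) x = ty l x
  mem : ∀ a x, σ.mem (2 * k + 1 + a) x = if a = 0 then w.getD x 0 else 0

variable {blk ty} {L M : ℕ} {w : List ℕ} {σ : RamState}

/-- Below 16, only register 1 (the constant one) and register 5 (the number of copies) are reserved.
Registers from 16 on and arrays from `2 * k + 1` on are the region of the solver; the arrays in
between hold the input and the two tables. -/
theorem Core.setReg (h : Core k L blk ty w σ) {r : ℕ} (hr : r < 16) (h₁ : r ≠ 1) (h₅ : r ≠ 5)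
    (v : ℕ) : Core k L blk ty w (σ.setReg r v) where
  one := by rw [RamState.reg_setReg, if_neg h₁.symm, h.one]
  len := by rw [RamState.reg_setReg, if_neg h₅.symm, h.len]
  out s := by rw [RamState.reg_setReg, if_neg (by lia), h.out]
  blk := h.blk
  ty := h.ty
  mem := h.mem

/-- Write `c` to the output. -/
def emit (k c : ℕ) : RamProg :=
  .seq (.const 11 c) (.seq (.store (2 * k + 1) 16 11) (.add 16 16 1))

/-- The registers that the output of a number leaves alone. -/
def Same (σ σ' : RamState) : Prop := ∀ r < 11, σ'.reg r = σ.reg r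

theorem Same.setReg {r : ℕ} (hr : 11 ≤ r) (v : ℕ) : Same σ (σ.setReg r v) := fun s hs => by
  rw [RamState.reg_setReg, if_neg (by lia)]

theorem Same.trans {σ₁ σ₂ σ₃ : RamState} (h : Same σ₁ σ₂) (h' : Same σ₂ σ₃) : Same σ₁ σ₃ :=
  fun r hr => (h' r hr).trans (h r hr)

theorem wp_emit (h : Core k L blk ty w σ) {c : ℕ} (hc : c.size ≤ M) :
    (emit k c).Wp σ (M + 3) fun σ' => Core k L blk ty (w ++ [c]) σ' ∧ Same σ σ' := by
  refine RamProg.Wp.mono (.seq (.const (.seq (.store (.add ?_))))) (by lia) fun _ h => h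
  have h16 : σ.reg 16 = w.length := by simpa using h.out 0
  refine ⟨⟨?_, ?_, fun r => ?_, fun l hl x hx => ?_, fun l hl x hx => ?_, fun a x => ?_⟩,
    fun r hr => ?_⟩
  · simp [RamState.reg_setReg, RamState.reg_setMem, h.one]
  · simp [RamState.reg_setReg, RamState.reg_setMem, h.len]
  · have := h.out r
    have h1 := h.one
    by_cases hr : r = 0
    · simp [RamState.reg_setReg, RamState.reg_setMem, h1, h16, hr]
    · have hr' : 16 + r ≠ 11 := by lia
      simp [RamState.reg_setReg, RamState.reg_setMem, this, hr, hr']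
  · simp only [RamState.mem_setReg, RamState.mem_setMem]
    rw [if_neg (by lia), h.blk l hl x hx]
  · simp only [RamState.mem_setReg, RamState.mem_setMem]
    rw [if_neg (by lia), h.ty l hl x hx]
  · simp only [RamState.mem_setReg, RamState.mem_setMem, RamState.reg_setReg]
    rw [h.mem]
    by_cases ha : a = 0
    · subst ha
      simp only [add_zero, true_and, Nat.reduceEqDiff, if_false, if_true, h16]
      rcases lt_trichotomy x w.length with hx | hx | hx
      · rw [if_neg (by lia), List.getD_append _ _ _ _ hx]
      · rw [if_pos hx, List.getD_append_right _ _ _ _ (by lia), hx]; simp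
      · rw [if_neg (by lia), List.getD_append_right _ _ _ _ (by lia),
          List.getD_eq_default _ _ (by lia), List.getD_eq_default _ _ (by simp; lia)]
    · simp [ha]
  · simp [RamState.reg_setReg, RamState.reg_setMem, show r ≠ 16 by lia, show r ≠ 11 by lia]

/-- Write the entry for two vertices of different copies, whose numbers are in registers. -/
def emitCross (x : Option (Fin k × Fin k)) (r s : ℕ) : RamProg :=
  x.elim (emit k 0) fun l =>
    .seq (.load 11 (1 + l.1) r) (.seq (.load 12 (1 + l.2) s) (.seq (.sub 13 11 12)
      (.seq (.sub 14 12 11) (.seq (.add 13 13 14) (.ite 13 (emit k 0) (emit k 1))))))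

/-- Two block numbers are equal exactly if both truncated differences vanish, which is tested on
their sum. -/
theorem wp_emitCross (h : Core k L blk ty w σ) (hM : 1 ≤ M) (x : Option (Fin k × Fin k))
    {r s t t' : ℕ} (hr : σ.reg r = t) (hs : σ.reg s = t') (hs' : s < 11)
    (ht : t < L) (ht' : t' < L) :
    (emitCross x r s).Wp σ (M + 9) fun σ' =>
      Core k L blk ty (w ++ [cross blk x t t']) σ' ∧ Same σ σ' := by
  rcases x with _ | ⟨l, l'⟩
  · exact (wp_emit (M := M) h (by simp)).mono (by lia) fun _ h => h
  · have hw : ∀ v₁ v₂ v₃ v₄ v₅ c, c ≤ 1 → (emit k c).Wp (((((σ.setReg 11 v₁).setReg 12 v₂).setReg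
        13 v₃).setReg 14 v₄).setReg 13 v₅) (M + 3)
        fun σ' => Core k L blk ty (w ++ [c]) σ' ∧ Same σ σ' := fun v₁ v₂ v₃ v₄ v₅ c hc =>
      (wp_emit (((((h.setReg (by lia) (by lia) (by lia) _).setReg (by lia) (by lia)
        (by lia) _).setReg (by lia) (by lia) (by lia) _).setReg (by lia) (by lia)
        (by lia) _).setReg (by lia) (by lia) (by lia) _)
        ((Nat.size_le_size hc).trans (by simpa using hM))).mono le_rfl fun σ' h' =>
        ⟨h'.1, ((((Same.setReg (by lia) _).trans (.setReg (by lia) _)).trans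
          (.setReg (by lia) _)).trans (.setReg (by lia) _)).trans
            ((Same.setReg (by lia) _).trans h'.2)⟩
    have hr11 : s ≠ 11 := by lia
    refine RamProg.Wp.mono (.seq (.load (.seq (.load (.seq (.sub (.seq (.sub (.seq (.add
      (.ite (n := M + 3) (fun hne => ?_) fun he => ?_)))))))))))  (by lia) fun _ h => h
    · simp [RamState.reg_setReg, RamState.mem_setReg, hr, hs, hr11, h.blk l l.2 t ht,
        h.blk l' l'.2 t' ht'] at hne
      have : cross blk (some (l, l')) t t' = 0 := by
        simp only [cross, Option.elim_some]; rw [if_neg (by lia)]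
      rw [this]
      exact hw _ _ _ _ _ _ (by lia)
    · simp [RamState.reg_setReg, RamState.mem_setReg, hr, hs, hr11, h.blk l l.2 t ht,
        h.blk l' l'.2 t' ht'] at he
      have : cross blk (some (l, l')) t t' = 1 := by
        simp only [cross, Option.elim_some]; rw [if_pos (by lia)]
      rw [this]
      exact hw _ _ _ _ _ _ (by lia)

/-- Write an entry of the adjacency matrix; the copies are in registers `2` and `3`. -/
def emitBit (j j' : Fin g) : RamProg :=
  .seq (.sub 11 2 3) (.seq (.sub 12 3 2) (.ite 11 (emitCross (γ.link j j') 2 3)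
    (.ite 12 (emitCross (γ.link j' j) 3 2) (emit k (γ.adj j j')))))

theorem wp_emitBit (h : Core k L blk ty w σ) (hM : γ.Bdd M) (j j' : Fin g) {t t' : ℕ}
    (hr : σ.reg 2 = t) (hs : σ.reg 3 = t') (ht : t < L) (ht' : t' < L) :
    (γ.emitBit j j').Wp σ (M + 13) fun σ' =>
      Core k L blk ty (w ++ [γ.bit blk t j t' j']) σ' ∧ Same σ σ' := by
  have hc : ∀ v₁ v₂, Core k L blk ty w ((σ.setReg 11 v₁).setReg 12 v₂) := fun v₁ v₂ =>
    (h.setReg (by lia) (by lia) (by lia) _).setReg (by lia) (by lia) (by lia) _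
  have hs' : ∀ v₁ v₂, Same σ ((σ.setReg 11 v₁).setReg 12 v₂) := fun v₁ v₂ =>
    (Same.setReg (by lia) _).trans (.setReg (by lia) _)
  refine RamProg.Wp.mono (.seq (.sub (.seq (.sub (.ite (n := M + 10) (fun hne => ?_) fun he =>
    .ite (n := M + 9) (fun hne => ?_) fun he' => ?_))))) (by lia) fun _ h => h
  · simp [RamState.reg_setReg, hr, hs] at hne
    rw [bit, if_pos (by lia)]
    exact (wp_emitCross (hc _ _) hM.1 _ (by simp [RamState.reg_setReg, hr])
      (by simp [RamState.reg_setReg, hs]) (by lia) ht ht').mono (by lia)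
      fun σ' h' => ⟨h'.1, (hs' _ _).trans h'.2⟩
  · simp [RamState.reg_setReg, hr, hs] at hne he
    rw [bit, if_neg (by lia), if_pos (by lia)]
    exact (wp_emitCross (hc _ _) hM.1 _ (by simp [RamState.reg_setReg, hs])
      (by simp [RamState.reg_setReg, hr]) (by lia) ht' ht).mono (by lia)
      fun σ' h' => ⟨h'.1, (hs' _ _).trans h'.2⟩
  · simp [RamState.reg_setReg, hr, hs] at he' he
    rw [bit, if_neg (by lia), if_neg (by lia)]
    exact (wp_emit (M := M) (hc _ _) (hM.2.1 _ _)).mono (by lia)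
      fun σ' h' => ⟨h'.1, (hs' _ _).trans h'.2⟩

/-- Write the code of the image of a vertex; the copy is in register `2`. -/
def emitPin (j : Fin g) : RamProg :=
  (γ.cond j).elim (emit k (γ.val j)) fun c =>
    .seq (.load 11 (1 + k + c.1) 2) (.seq (.const 12 c.2) (.seq (.sub 13 11 12)
      (.seq (.sub 14 12 11) (.seq (.add 13 13 14) (.ite 13 (emit k 0) (emit k (γ.val j)))))))

theorem wp_emitPin (h : Core k L blk ty w σ) (hM : γ.Bdd M) (j : Fin g) {t : ℕ}
    (hr : σ.reg 2 = t) (ht : t < L) :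
    (γ.emitPin j).Wp σ (2 * M + 9) fun σ' =>
      Core k L blk ty (w ++ [γ.pin ty t j]) σ' ∧ Same σ σ' := by
  have hcond := hM.2.2.2 j
  rw [emitPin, pin]
  rcases hj : γ.cond j with _ | ⟨l, θ⟩
  · exact (wp_emit (M := M) h (hM.2.2.1 j)).mono (by lia) fun _ h => h
  · have hθ : θ.size ≤ M := hcond (l, θ) hj
    have hw : ∀ v₁ v₂ v₃ v₄ v₅ c, Nat.size c ≤ M → (emit k c).Wp (((((σ.setReg 11 v₁).setReg 12
        v₂).setReg 13 v₃).setReg 14 v₄).setReg 13 v₅) (M + 3)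
        fun σ' => Core k L blk ty (w ++ [c]) σ' ∧ Same σ σ' := fun v₁ v₂ v₃ v₄ v₅ c hc =>
      (wp_emit (((((h.setReg (by lia) (by lia) (by lia) _).setReg (by lia) (by lia)
        (by lia) _).setReg (by lia) (by lia) (by lia) _).setReg (by lia) (by lia)
        (by lia) _).setReg (by lia) (by lia) (by lia) _) hc).mono le_rfl fun σ' h' =>
        ⟨h'.1, ((((Same.setReg (by lia) _).trans (.setReg (by lia) _)).trans
          (.setReg (by lia) _)).trans (.setReg (by lia) _)).trans
            ((Same.setReg (by lia) _).trans h'.2)⟩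
    refine RamProg.Wp.mono (.seq (.load (.seq (.const (.seq (.sub (.seq (.sub (.seq (.add
      (.ite (n := M + 3) (fun hne => ?_) fun he => ?_)))))))))))  (by lia) fun _ h => h
    · simp [RamState.reg_setReg, hr, h.ty l l.2 t ht] at hne
      simp only [Option.elim_some]
      rw [if_neg (by lia)]
      exact hw _ _ _ _ _ _ (by simp)
    · simp [RamState.reg_setReg, hr, h.ty l l.2 t ht] at he
      simp only [Option.elim_some]
      rw [if_pos (by lia)]
      exact hw _ _ _ _ _ _ (hM.2.2.1 j)

end GadgetCode

/-! ### Nested loops that write the instance, and the division of literal codes -/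

namespace GadgetCode

variable {k g : ℕ} (γ : GadgetCode k g) {blk ty : ℕ → ℕ → ℕ} {L M : ℕ} {w : List ℕ} {σ : RamState}

/-- Run `body` for each copy of the gadget, with the number of the copy in register `r`. -/
def forCopies (r c : ℕ) (body : RamProg) : RamProg :=
  .seq (.const r 0) (.seq (.add c 5 r) (.loop c (.seq body (.seq (.add r r 1) (.sub c c 1)))))

/-- `S` holds the registers on which enclosing loops rely. The body has to preserve these and the
two counters of this loop, which makes the lemma nestable. -/
theorem wp_forCopies {r c n : ℕ} {body : RamProg} {f : ℕ → List ℕ} (S : Set ℕ)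
    (hr : r < 16) (hr₁ : r ≠ 1) (hr₅ : r ≠ 5) (hc : c < 16) (hc₁ : c ≠ 1) (hc₅ : c ≠ 5)
    (hrc : r ≠ c) (hrS : r ∉ S) (hcS : c ∉ S) (h : Core k L blk ty w σ)
    (hbody : ∀ t < L, ∀ w σ', Core k L blk ty w σ' → σ'.reg r = t →
      (∀ s ∈ S, σ'.reg s = σ.reg s) → body.Wp σ' n fun σ'' =>
        Core k L blk ty (w ++ f t) σ'' ∧ ∀ s ∈ insert r (insert c S), σ''.reg s = σ'.reg s) :
    (forCopies r c body).Wp σ (L * (n + 3) + 3) fun σ' =>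
      Core k L blk ty (w ++ (List.range L).flatMap f) σ' ∧ ∀ s ∈ S, σ'.reg s = σ.reg s := by
  have hne : ∀ s ∈ S, s ≠ r ∧ s ≠ c := fun s hs =>
    ⟨fun e => hrS (e ▸ hs), fun e => hcS (e ▸ hs)⟩
  refine RamProg.Wp.mono (.seq (.const (.seq (.add (.loop (m := L) (n := n + 2) (fun t σ' =>
    Core k L blk ty (w ++ (List.range t).flatMap f) σ' ∧ σ'.reg r = t ∧ σ'.reg c = L - t ∧
      ∀ s ∈ S, σ'.reg s = σ.reg s) ?_ ?_ ?_ ?_))))) (by simp; lia) fun σ' h => ⟨h.1, h.2.2.2⟩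
  · rintro t ht σ' ⟨-, -, h, -⟩
    lia
  · rintro σ' ⟨-, -, h, -⟩
    lia
  · rintro t ht σ' ⟨h₁, h₂, h₃, h₄⟩
    refine (RamProg.Wp.seq ((hbody t ht _ σ' h₁ h₂ h₄).mono le_rfl fun σ₂ ⟨h₅, h₆⟩ =>
      .seq (.add (.sub ?_)))).mono le_rfl fun _ h => h
    have e₁ := h₆ r (by simp)
    have e₂ := h₆ c (by simp)
    refine ⟨?_, ?_, ?_, fun s hs => ?_⟩
    · have := (h₅.setReg hr hr₁ hr₅ (σ₂.reg r + σ₂.reg 1)).setReg hc hc₁ hc₅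
        ((σ₂.setReg r (σ₂.reg r + σ₂.reg 1)).reg c -
          (σ₂.setReg r (σ₂.reg r + σ₂.reg 1)).reg 1)
      simpa [List.range_succ, List.flatMap_append] using this
    · simp [RamState.reg_setReg, hrc, e₁, h₂, h₅.one]
    · simp [RamState.reg_setReg, hrc.symm, hr₁.symm, e₂, h₃, h₅.one]
      lia
    · simp [RamState.reg_setReg, hne s hs, h₆ s (by simp [hs]), h₄ s hs]
  · refine ⟨?_, ?_, ?_, fun s hs => ?_⟩
    · simpa using (h.setReg hr hr₁ hr₅ 0).setReg hc hc₁ hc₅ _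
    · simp [RamState.reg_setReg, hrc]
    · simp [RamState.reg_setReg, hr₅.symm, h.len]
    · simp [RamState.reg_setReg, hne s hs]

theorem wp_forVertices {n : ℕ} {body : Fin g → RamProg} {f : Fin g → List ℕ} (S : Set ℕ)
    (h : Core k L blk ty w σ)
    (hbody : ∀ j w σ', Core k L blk ty w σ' → (∀ s ∈ S, σ'.reg s = σ.reg s) →
      (body j).Wp σ' n fun σ'' =>
        Core k L blk ty (w ++ f j) σ'' ∧ ∀ s ∈ S, σ''.reg s = σ'.reg s) :
    (RamProg.seqList ((List.finRange g).map body)).Wp σ (g * n + 1) fun σ' =>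
      Core k L blk ty (w ++ (List.finRange g).flatMap f) σ' ∧ ∀ s ∈ S, σ'.reg s = σ.reg s := by
  refine (RamProg.Wp.seqList (n := n) (fun pre σ' => Core k L blk ty (w ++ pre.flatMap f) σ' ∧
    ∀ s ∈ S, σ'.reg s = σ.reg s) ?_ ⟨by simpa using h, fun _ _ => rfl⟩).mono (by simp) fun _ h => h
  rintro pre j σ' ⟨h₁, h₂⟩
  refine (hbody j _ σ' h₁ h₂).mono le_rfl fun σ₂ h₃ =>
    ⟨by simpa [List.flatMap_append] using h₃.1, fun s hs => (h₃.2 s hs).trans (h₂ s hs)⟩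

/-- Write the adjacency matrix. -/
def emitMatrix : RamProg :=
  forCopies 2 9 (.seqList ((List.finRange g).map fun j =>
    forCopies 3 10 (.seqList ((List.finRange g).map fun j' => γ.emitBit j j'))))

/-- The adjacency matrix of the first `L` copies, row by row. -/
def matrix (blk : ℕ → ℕ → ℕ) (L : ℕ) : List ℕ :=
  (List.range L).flatMap fun t => (List.finRange g).flatMap fun j =>
    (List.range L).flatMap fun t' => (List.finRange g).flatMap fun j' => [γ.bit blk t j t' j']

theorem wp_emitMatrix (h : Core k L blk ty w σ) (hM : γ.Bdd M) :
    γ.emitMatrix.Wp σ (L * (g * (L * (g * (M + 13) + 1 + 3) + 3) + 1 + 3) + 3) fun σ' =>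
      Core k L blk ty (w ++ γ.matrix blk L) σ' := by
  refine (wp_forCopies ∅ (by lia) (by lia) (by lia) (by lia) (by lia) (by lia) (by lia) (by simp)
    (by simp) h fun t ht w σ₁ h₁ ht₁ _ => ?_).mono le_rfl fun _ h => h.1
  refine wp_forVertices (insert 2 (insert 9 ∅)) h₁ fun j w σ₂ h₂ hs₂ => ?_
  have ht₂ : σ₂.reg 2 = t := (hs₂ 2 (by simp)).trans ht₁
  refine wp_forCopies (r := 3) (c := 10) (insert 2 (insert 9 ∅)) (by lia) (by lia) (by lia) (by lia) (by lia) (by lia) (by lia)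
    (by simp) (by simp) h₂ fun t' ht' w σ₃ h₃ ht₃ hs₃ => ?_
  refine wp_forVertices (insert 3 (insert 10 (insert 2 (insert 9 ∅)))) h₃ fun j' w σ₄ h₄ hs₄ => ?_
  have e₂ : σ₄.reg 2 = t := (hs₄ 2 (by simp)).trans ((hs₃ 2 (by simp)).trans ht₂)
  have e₃ : σ₄.reg 3 = t' := (hs₄ 3 (by simp)).trans ht₃
  refine (γ.wp_emitBit h₄ hM j j' e₂ e₃ ht ht').mono le_rfl fun σ₅ h₅ => ⟨h₅.1, fun s hs => ?_⟩
  refine h₅.2 s ?_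
  simp only [Set.mem_insert_iff, Set.mem_empty_iff_false] at hs
  lia

/-- Write the partial map. -/
def emitPins : RamProg :=
  forCopies 2 9 (.seqList ((List.finRange g).map γ.emitPin))

/-- The partial map on the first `L` copies. -/
def pins (ty : ℕ → ℕ → ℕ) (L : ℕ) : List ℕ :=
  (List.range L).flatMap fun t => (List.finRange g).flatMap fun j => [γ.pin ty t j]

theorem wp_emitPins (h : Core k L blk ty w σ) (hM : γ.Bdd M) :
    γ.emitPins.Wp σ (L * (g * (2 * M + 9) + 1 + 3) + 3) fun σ' =>
      Core k L blk ty (w ++ γ.pins ty L) σ' := by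
  refine (wp_forCopies ∅ (by lia) (by lia) (by lia) (by lia) (by lia) (by lia) (by lia) (by simp)
    (by simp) h fun t ht w σ₁ h₁ ht₁ _ => ?_).mono le_rfl fun _ h => h.1
  refine wp_forVertices (insert 2 (insert 9 ∅)) h₁ fun j w σ₂ h₂ hs₂ => ?_
  have ht₂ : σ₂.reg 2 = t := (hs₂ 2 (by simp)).trans ht₁
  refine (γ.wp_emitPin h₂ hM j ht₂ ht).mono le_rfl fun σ₅ h₅ => ⟨h₅.1, fun s hs => ?_⟩
  refine h₅.2 s ?_
  simp only [Set.mem_insert_iff, Set.mem_empty_iff_false] at hs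
  lia

/-! ### The tables of the blocks and types of the literals -/

/-- The invariant of the table phase: the tables are filled for the first `t` copies. -/
structure Tab (k g C D : ℕ) (lit : ℕ → ℕ → ℕ) (t : ℕ) (σ : RamState) : Prop where
  one : σ.reg 1 = 1
  cl : σ.reg 7 = C
  div : σ.reg 13 = D
  siz : σ.reg 15 = g
  cur : σ.reg 2 = t
  num : σ.reg 6 = t * g
  inp : ∀ c < C, ∀ l < k, σ.mem 0 (2 + c * k + l) = lit c l
  blk : ∀ l < k, ∀ x < t, σ.mem (1 + l) x = lit (x % C) l / D
  ty : ∀ l < k, ∀ x < t, σ.mem (1 + k + l) x = lit (x % C) l % D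
  reg : ∀ r, σ.reg (16 + r) = 0
  mem : ∀ a x, σ.mem (2 * k + 1 + a) x = 0

variable {C D t : ℕ} {lit : ℕ → ℕ → ℕ}

theorem Tab.of_eq (h : Tab k g C D lit t σ) {σ' : RamState} (hm : σ'.mem = σ.mem)
    (hr : ∀ r, r = 1 ∨ r = 7 ∨ r = 13 ∨ r = 15 ∨ r = 2 ∨ r = 6 ∨ 16 ≤ r →
      σ'.reg r = σ.reg r) : Tab k g C D lit t σ' where
  one := by rw [hr _ (by lia), h.one]
  cl := by rw [hr _ (by lia), h.cl]
  div := by rw [hr _ (by lia), h.div]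
  siz := by rw [hr _ (by lia), h.siz]
  cur := by rw [hr _ (by lia), h.cur]
  num := by rw [hr _ (by lia), h.num]
  inp := by rw [hm]; exact h.inp
  blk := by rw [hm]; exact h.blk
  ty := by rw [hm]; exact h.ty
  reg r := by rw [hr _ (by lia), h.reg]
  mem := by rw [hm]; exact h.mem

/-- Division of register `11` by register `13`: quotient in `12`, remainder in `11`. -/
def divide : RamProg :=
  .seq (.const 12 0) (.seq (.add 10 11 1) (.seq (.sub 10 10 13) (.loop 10
    (.seq (.sub 11 11 13) (.seq (.add 12 12 1) (.seq (.add 10 11 1) (.sub 10 10 13)))))))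

/-- Repeated subtraction is fast enough because literal codes are at most linear in the number of
variables. Register 10 holds the current dividend plus one, minus `D`, truncated: it is non-zero
exactly while another subtraction is possible. -/
theorem wp_divide {v B : ℕ} (hD : 0 < D) (h₁ : σ.reg 1 = 1) (h₁₃ : σ.reg 13 = D)
    (h₁₁ : σ.reg 11 = v) (hv : v ≤ B) : divide.Wp σ (B * 5 + 4) fun σ' =>
      σ'.mem = σ.mem ∧ σ'.reg 11 = v % D ∧ σ'.reg 12 = v / D ∧
        ∀ r, r ≠ 10 → r ≠ 11 → r ≠ 12 → σ'.reg r = σ.reg r := by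
  have hle : v / D ≤ B := (Nat.div_le_self _ _).trans hv
  have hdm := Nat.div_add_mod v D
  have hlt := Nat.mod_lt v hD
  refine RamProg.Wp.mono (.seq (.const (.seq (.add (.seq (.sub (.loop (m := v / D) (n := 4)
    (fun i σ' => σ'.mem = σ.mem ∧ σ'.reg 11 = v - i * D ∧ σ'.reg 12 = i ∧
      σ'.reg 10 = v - i * D + 1 - D ∧
      ∀ r, r ≠ 10 → r ≠ 11 → r ≠ 12 → σ'.reg r = σ.reg r) ?_ ?_ ?_ ?_)))))))
      (by simp; lia) ?_
  · rintro i hi σ' ⟨-, -, -, h, -⟩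
    have : (i + 1) * D ≤ v := (Nat.mul_le_mul_right D hi).trans (Nat.div_mul_le_self v D)
    rw [add_mul] at this
    lia
  · rintro σ' ⟨-, -, -, h, -⟩
    rw [mul_comm] at h
    lia
  · rintro i hi σ' ⟨e₁, e₂, e₃, e₄, e₅⟩
    refine RamProg.Wp.mono (.seq (.sub (.seq (.add (.seq (.add (.sub ?_)))))))
      (by lia) fun _ h => h
    have e₆ := e₅ 1 (by lia) (by lia) (by lia)
    have e₇ := e₅ 13 (by lia) (by lia) (by lia)
    have e₈ : v - i * D - D = v - (i + 1) * D := by rw [add_mul]; lia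
    refine ⟨e₁, ?_, ?_, ?_, fun r a b c => ?_⟩
    · simp [RamState.reg_setReg, e₂, e₇, h₁₃, e₈]
    · simp [RamState.reg_setReg, e₃, e₆, h₁]
    · simp [RamState.reg_setReg, e₂, e₆, e₇, h₁, h₁₃, e₈]
    · simp [RamState.reg_setReg, a, b, c, e₅]
  · refine ⟨rfl, ?_, ?_, ?_, fun r a b c => ?_⟩
    · simp [RamState.reg_setReg, h₁₁]
    · simp [RamState.reg_setReg]
    · simp [RamState.reg_setReg, h₁₁, h₁, h₁₃]
    · simp [RamState.reg_setReg, a, c]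
  · rintro σ' ⟨e₁, e₂, e₃, e₄, e₅⟩
    refine ⟨e₁, ?_, e₃, e₅⟩
    rw [e₂, mul_comm]; lia

/-- Enter the literal of the current clause in slot `l` into the tables. -/
def enterLiteral (k l : ℕ) : RamProg :=
  .seq (.const 11 l) (.seq (.add 11 11 14) (.seq (.load 11 0 11) (.seq divide
    (.seq (.store (1 + l) 2 12) (.store (1 + k + l) 2 11)))))

/-- Enter the literals of the current clause into the tables. -/
def enterClause (k : ℕ) : RamProg :=
  .seqList ((List.finRange k).map fun l : Fin k => enterLiteral k l)

theorem wp_enterClause {B c : ℕ} (h : Tab k g C D lit t σ) (hD : 0 < D) (hc : c < C)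
    (ht : t % C = c) (h₁₄ : σ.reg 14 = 2 + c * k) (hB : ∀ c < C, ∀ l < k, lit c l ≤ B) :
    (enterClause k).Wp σ (k * (B * 5 + 9 + k) + 1) fun σ' =>
      (∀ r, r ≠ 10 → r ≠ 11 → r ≠ 12 → σ'.reg r = σ.reg r) ∧
      (∀ l < k, ∀ x < t + 1, σ'.mem (1 + l) x = lit (x % C) l / D) ∧
      (∀ l < k, ∀ x < t + 1, σ'.mem (1 + k + l) x = lit (x % C) l % D) ∧
      (σ'.mem 0 = σ.mem 0) ∧ ∀ a, σ'.mem (2 * k + 1 + a) = σ.mem (2 * k + 1 + a) := by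
  rw [enterClause]
  -- The tables are complete below index `t`, and at `t` for the slots already treated. Index `x`
  -- belongs to clause `x % C`, since the clauses are traversed repeatedly.
  refine (RamProg.Wp.seqList (xs := List.finRange k) (n := B * 5 + 9 + k) (fun (pre : List (Fin k)) σ' =>
      (∀ r, r ≠ 10 → r ≠ 11 → r ≠ 12 → σ'.reg r = σ.reg r) ∧
      (∀ l : Fin k, ∀ x, x < t ∨ x = t ∧ l ∈ pre → σ'.mem (1 + l) x = lit (x % C) l / D) ∧
      (∀ l : Fin k, ∀ x, x < t ∨ x = t ∧ l ∈ pre → σ'.mem (1 + k + l) x = lit (x % C) l % D) ∧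
      (σ'.mem 0 = σ.mem 0) ∧ ∀ a, σ'.mem (2 * k + 1 + a) = σ.mem (2 * k + 1 + a)) ?_ ?_).mono
    (by simp) ?_
  · rintro pre l σ₁ ⟨e₁, e₂, e₃, e₄, e₅⟩
    have hl := l.2
    have hv : σ₁.mem 0 (l + σ₁.reg 14) = lit c l := by
      rw [e₄, e₁ 14 (by lia) (by lia) (by lia), h₁₄, ← h.inp c hc l l.2]
      congr 1; lia
    have hlk : Nat.size l ≤ k := by
      rw [Nat.size_le]; exact l.2.trans Nat.lt_two_pow_self
    refine RamProg.Wp.mono (.seq (.const (.seq (.add (.seq (.load (.seq ((wp_divide hD (v := lit c l)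
      (B := B) ?_ ?_ ?_ (hB c hc l l.2)).mono le_rfl fun σ₂ ⟨f₁, f₂, f₃, f₄⟩ =>
        .seq (.store (.store ?_)))))))))) (by lia) fun _ h => h
    · simp [RamState.reg_setReg, e₁, h.one]
    · simp [RamState.reg_setReg, e₁, h.div]
    · simpa [RamState.reg_setReg, RamState.mem_setReg] using hv
    · have f₅ : σ₂.reg 2 = t := by
        rw [f₄ 2 (by lia) (by lia) (by lia)]
        simp [RamState.reg_setReg, e₁, h.cur]
      simp only [RamState.reg_setMem, f₅, f₂, f₃]
      have f₆ : σ₂.mem = σ₁.mem := f₁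
      refine ⟨fun r a b c => ?_, fun l' x hx => ?_, fun l' x hx => ?_, ?_, fun a => ?_⟩
      · rw [f₄ r a b c]
        simp [RamState.reg_setReg, b, e₁ r a b c]
      · have hl' := l'.2
        rw [RamState.mem_setMem, if_neg (by lia), RamState.mem_setMem]
        by_cases hh : l' = l ∧ x = t
        · rw [if_pos (by simp [hh]), hh.1, hh.2, ht]
        · have : ¬ (1 + (l' : ℕ) = 1 + l ∧ x = t) := fun h' => hh ⟨Fin.ext (by lia), h'.2⟩
          rw [if_neg this, f₆, e₂ l' x]
          simp only [List.mem_append, List.mem_singleton] at hx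
          tauto
      · have hl' := l'.2
        rw [RamState.mem_setMem]
        by_cases hh : l' = l ∧ x = t
        · rw [if_pos (by simp [hh]), hh.1, hh.2, ht]
        · have : ¬ (1 + k + (l' : ℕ) = 1 + k + l ∧ x = t) := fun h' => hh ⟨Fin.ext (by lia), h'.2⟩
          rw [if_neg this, RamState.mem_setMem, if_neg (by lia), f₆, e₃ l' x]
          simp only [List.mem_append, List.mem_singleton] at hx
          tauto
      · funext x
        rw [RamState.mem_setMem, if_neg (by lia), RamState.mem_setMem, if_neg (by lia), f₆, e₄]
      · funext x
        rw [RamState.mem_setMem, if_neg (by lia), RamState.mem_setMem, if_neg (by lia), f₆, e₅]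
  · exact ⟨fun _ _ _ _ => rfl, fun l x hx => h.blk l l.2 x (by simpa using hx),
      fun l x hx => h.ty l l.2 x (by simpa using hx), rfl, fun _ => rfl⟩
  · rintro σ' ⟨e₁, e₂, e₃, e₄, e₅⟩
    exact ⟨e₁, fun l hl x hx => e₂ ⟨l, hl⟩ x (by simp; lia),
      fun l hl x hx => e₃ ⟨l, hl⟩ x (by simp; lia), e₄, e₅⟩

end GadgetCode

/-! ### Rounds through the clauses, and the complete reduction program -/

namespace GadgetCode

variable {k g : ℕ} (γ : GadgetCode k g) {L M : ℕ} {w : List ℕ} {σ : RamState}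
  {C D t : ℕ} {lit : ℕ → ℕ → ℕ}

/-- Go through the clauses once. -/
def enterRound (k : ℕ) : RamProg :=
  .seq (.const 14 2) (.seq (.const 11 0) (.seq (.add 9 7 11) (.loop 9
    (.seq (enterClause k) (.seq (.add 2 2 1) (.seq (.add 6 6 15) (.seq (.const 11 k)
      (.seq (.add 14 14 11) (.sub 9 9 1)))))))))

/-- Register 14 points to the current clause: two header entries precede the literals, and each
clause occupies `k` cells. -/
theorem wp_enterRound {B r : ℕ} (h : Tab k g C D lit (r * C) σ) (hD : 0 < D)
    (hB : ∀ c < C, ∀ l < k, lit c l ≤ B) :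
    (enterRound k).Wp σ (C * (k * (B * 5 + 9 + k) + k + 7) + 7) fun σ' =>
      Tab k g C D lit ((r + 1) * C) σ' ∧ σ'.reg 8 = σ.reg 8 := by
  refine RamProg.Wp.mono (.seq (.const (.seq (.const (.seq (.add (.loop (m := C)
    (n := k * (B * 5 + 9 + k) + k + 6) (fun c σ' => Tab k g C D lit (r * C + c) σ' ∧
      σ'.reg 8 = σ.reg 8 ∧ σ'.reg 9 = C - c ∧ σ'.reg 14 = 2 + c * k) ?_ ?_ ?_ ?_)))))))
      (by simp [show Nat.size 2 = 2 from rfl]; lia) fun σ' h => ⟨?_, h.2.1⟩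
  · rintro c hc σ' ⟨-, -, h, -⟩
    lia
  · rintro σ' ⟨-, -, h, -⟩
    lia
  · rintro c hc σ₁ ⟨h₁, h₂, h₃, h₄⟩
    have ht : (r * C + c) % C = c := by
      rw [mul_comm, Nat.mul_add_mod, Nat.mod_eq_of_lt hc]
    have hk : Nat.size k ≤ k := by rw [Nat.size_le]; exact Nat.lt_two_pow_self
    refine RamProg.Wp.mono (.seq ((wp_enterClause h₁ hD hc ht h₄ hB).mono le_rfl
      fun σ₂ ⟨e₁, e₂, e₃, e₄, e₅⟩ => .seq (.add (.seq (.add (.seq (.const (.seq (.add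
        (.sub ?_)))))))))) (by lia) fun _ h => h
    refine ⟨⟨?_, ?_, ?_, ?_, ?_, ?_, ?_, e₂, e₃, fun s => ?_, fun a x => ?_⟩, ?_, ?_, ?_⟩
    · simp [RamState.reg_setReg, e₁, h₁.one]
    · simp [RamState.reg_setReg, e₁, h₁.cl]
    · simp [RamState.reg_setReg, e₁, h₁.div]
    · simp [RamState.reg_setReg, e₁, h₁.siz]
    · simp [RamState.reg_setReg, e₁, h₁.cur, h₁.one]; lia
    · simp [RamState.reg_setReg, e₁, h₁.num, h₁.siz]; ring
    · intro c' hc' l hl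
      simp only [RamState.mem_setReg, e₄]
      exact h₁.inp c' hc' l hl
    · simp [RamState.reg_setReg, e₁ (16 + s) (by lia) (by lia) (by lia), h₁.reg]
      repeat rw [if_neg (by lia)]
    · simp only [RamState.mem_setReg, e₅]
      exact h₁.mem a x
    · simp [RamState.reg_setReg, e₁, h₂]
    · simp [RamState.reg_setReg, e₁, h₃, h₁.one]; lia
    · simp [RamState.reg_setReg, e₁, h₄]; ring
  · refine ⟨h.of_eq rfl fun s hs => ?_, ?_, ?_, ?_⟩
    · simp [RamState.reg_setReg, show s ≠ 14 by lia, show s ≠ 11 by lia, show s ≠ 9 by lia]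
    · simp [RamState.reg_setReg]
    · simp [RamState.reg_setReg, h.cl]
    · simp [RamState.reg_setReg]
  · rw [add_mul, one_mul]; exact h.1

/-- Set up the registers and compute the number of rounds `(n + 1) * r₀`. -/
def setup (D g r₀ : ℕ) : RamProg :=
  .seq (.const 1 1) (.seq (.const 13 D) (.seq (.const 15 g) (.seq (.const 11 0)
    (.seq (.load 12 0 11) (.seq (.load 7 0 1) (.seq (.const 14 r₀) (.seq (.add 10 12 1)
      (.seq (.const 8 0) (.loop 10 (.seq (.add 8 8 14) (.sub 10 10 1)))))))))))

/-- There is no multiplication, so the number of rounds arises by repeated addition. The factor `n +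
1` replaces the number of blocks, which then need not be computed. -/
theorem wp_setup {n r₀ : ℕ} {I : List ℕ} (h₀ : I.getD 0 0 = n) (h₁ : I.getD 1 0 = C)
    (hI : ∀ c < C, ∀ l < k, I.getD (2 + c * k + l) 0 = lit c l) :
    (setup D g r₀).Wp (RamState.init I) ((n + 1) * 3 + D + g + r₀ + 14) fun σ' =>
      Tab k g C D lit 0 σ' ∧ σ'.reg 8 = (n + 1) * r₀ := by
  have hs : ∀ x : ℕ, x.size ≤ x := fun x => by rw [Nat.size_le]; exact Nat.lt_two_pow_self
  have h1 := hs D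
  have h2 := hs g
  have h3 := hs r₀
  refine RamProg.Wp.mono (.seq (.const (.seq (.const (.seq (.const (.seq (.const (.seq (.load
    (.seq (.load (.seq (.const (.seq (.add (.seq (.const (.loop (m := n + 1) (n := 2) (fun i σ' =>
      Tab k g C D lit 0 σ' ∧ σ'.reg 14 = r₀ ∧ σ'.reg 8 = i * r₀ ∧ σ'.reg 10 = n + 1 - i)
        ?_ ?_ ?_ ?_)))))))))))))))))))
      (by simp; lia) fun σ' h => ⟨h.1, h.2.2.1⟩
  · rintro c hc σ' ⟨-, -, -, h⟩
    lia
  · rintro σ' ⟨-, -, -, h⟩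
    lia
  · rintro i hi σ' ⟨e₁, e₂, e₃, e₄⟩
    refine .seq (.add (.sub ⟨e₁.of_eq rfl fun s hs => ?_, ?_, ?_, ?_⟩))
    · simp [RamState.reg_setReg, show s ≠ 8 by lia, show s ≠ 10 by lia]
    · simp [RamState.reg_setReg, e₂]
    · simp [RamState.reg_setReg, e₂, e₃]; ring
    · simp [RamState.reg_setReg, e₁.one, e₄]; lia
  · have hn : I[0]?.getD 0 = n := by simpa using h₀
    have hC : I[1]?.getD 0 = C := by simpa using h₁
    refine ⟨⟨?_, ?_, ?_, ?_, ?_, ?_, fun c hc l hl => ?_, by simp, by simp, fun s => ?_,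
      fun a x => ?_⟩, ?_, ?_, ?_⟩
    any_goals simp [RamState.reg_setReg, RamState.mem_setReg, RamState.init, hn, hC]
    · simpa using hI c hc l hl
    · intros
      repeat rw [if_neg (by lia)]

/-- Fill the tables and write the number of vertices. -/
def tables (k D g r₀ : ℕ) : RamProg :=
  .seq (setup D g r₀) (.seq (.loop 8 (.seq (enterRound k) (.sub 8 8 1)))
    (.seq (.const 11 0) (.seq (.add 5 2 11) (.seq (.store (2 * k + 1) 11 6) (.add 16 11 1)))))

theorem wp_tables {n r₀ B : ℕ} {I : List ℕ} (h₀ : I.getD 0 0 = n) (h₁ : I.getD 1 0 = C)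
    (hI : ∀ c < C, ∀ l < k, I.getD (2 + c * k + l) 0 = lit c l) (hD : 0 < D)
    (hB : ∀ c < C, ∀ l < k, lit c l ≤ B) :
    (tables k D g r₀).Wp (RamState.init I) ((n + 1) * 3 + D + g + r₀ + 14 +
      ((n + 1) * r₀ * (C * (k * (B * 5 + 9 + k) + k + 7) + 9) + 5)) fun σ' =>
      Core k ((n + 1) * r₀ * C) (fun l x => lit (x % C) l / D) (fun l x => lit (x % C) l % D)
        [(n + 1) * r₀ * C * g] σ' := by
  refine RamProg.Wp.mono (.seq ((wp_setup h₀ h₁ hI).mono le_rfl fun σ₁ ⟨e₁, e₂⟩ =>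
    .seq ((RamProg.Wp.loop (m := (n + 1) * r₀)
      (n := C * (k * (B * 5 + 9 + k) + k + 7) + 7 + 1) (fun r σ' => Tab k g C D lit (r * C) σ' ∧
      σ'.reg 8 = (n + 1) * r₀ - r) ?_ ?_ ?_ ?_).mono le_rfl fun σ₂ ⟨h, _⟩ =>
        .seq (.const (.seq (.add (.seq (.store (.add ?_)))))))))
    (by simp) fun _ h => h
  · rintro r hr σ' ⟨-, h⟩
    lia
  · rintro σ' ⟨-, h⟩
    lia
  · rintro r hr σ' ⟨h, h'⟩
    refine .seq ((wp_enterRound h hD hB).mono le_rfl fun σ'' ⟨f₁, f₂⟩ => .sub ⟨f₁.of_eq rfl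
      fun s hs => ?_, ?_⟩)
    · rw [RamState.reg_setReg, if_neg (by lia)]
    · simp [RamState.reg_setReg, f₁.one, f₂, h']; lia
  · exact ⟨by simpa using e₁, by simpa using e₂⟩
  · refine ⟨?_, ?_, fun r => ?_, fun l hl x hx => ?_, fun l hl x hx => ?_, fun a x => ?_⟩
    · simp [RamState.reg_setReg, RamState.reg_setMem, h.one]
    · simp [RamState.reg_setReg, RamState.reg_setMem, h.cur]
    · by_cases hr : r = 0
      · simp [RamState.reg_setReg, RamState.reg_setMem, h.one, hr]
      · have a₁ : 16 + r ≠ 11 := by lia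
        have a₂ : 16 + r ≠ 5 := by lia
        simp [RamState.reg_setReg, RamState.reg_setMem, hr, a₁, a₂, h.reg]
    · simp only [RamState.mem_setReg, RamState.mem_setMem]
      rw [if_neg (by lia), h.blk l hl x hx]
    · simp only [RamState.mem_setReg, RamState.mem_setMem]
      rw [if_neg (by lia), h.ty l hl x hx]
    · simp only [RamState.mem_setReg, RamState.mem_setMem]
      by_cases ha : a = 0
      · rcases x with _ | x <;> simp [ha, RamState.reg_setReg, h.num]
        simpa using h.mem 0 (x + 1)
      · simp [ha, h.mem]

/-- The reduction: write down the instance for the input formula. -/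
def reduction (D r₀ : ℕ) : RamProg :=
  .seq (tables k D g r₀) (.seq γ.emitMatrix γ.emitPins)

/-- The output of the reduction with `L` copies. -/
def output (blk ty : ℕ → ℕ → ℕ) (L : ℕ) : List ℕ :=
  L * g :: (γ.matrix blk L ++ γ.pins ty L)

/-- The region beyond register 16 and array `2 * k + 1` is touched only to store the output and its
length, so afterwards it is an initial state for the solver. -/
theorem wp_reduction {n r₀ B : ℕ} {I : List ℕ} (h₀ : I.getD 0 0 = n) (h₁ : I.getD 1 0 = C)
    (hI : ∀ c < C, ∀ l < k, I.getD (2 + c * k + l) 0 = lit c l) (hD : 0 < D)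
    (hB : ∀ c < C, ∀ l < k, lit c l ≤ B) (hM : γ.Bdd M) (hL : L = (n + 1) * r₀ * C) :
    (γ.reduction D r₀).Wp (RamState.init I) ((n + 1) * 3 + D + g + r₀ + 14 +
      ((n + 1) * r₀ * (C * (k * (B * 5 + 9 + k) + k + 7) + 9) + 5) +
      ((L * (g * (L * (g * (M + 13) + 1 + 3) + 3) + 1 + 3) + 3) +
        (L * (g * (2 * M + 9) + 1 + 3) + 3))) fun σ' =>
      σ'.Contains 16 (2 * k + 1) (RamState.init
        (γ.output (fun l x => lit (x % C) l / D) (fun l x => lit (x % C) l % D) L)) := by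
  subst hL
  refine .seq ((wp_tables h₀ h₁ hI hD hB).mono le_rfl fun σ₁ e₁ => .seq
    ((γ.wp_emitMatrix e₁ hM).mono le_rfl fun σ₂ e₂ => (γ.wp_emitPins e₂ hM).mono le_rfl
      fun σ₃ e₃ => ⟨fun r => ?_, fun a x => ?_⟩))
  · rw [e₃.out]
    simp [RamState.init, output]
  · rw [e₃.mem]
    simp [RamState.init, output]

end GadgetCode

/-! ### Clique-width of graphs built from copies of a gadget -/

/-- Up to isomorphism, the labelled graph is the evaluation of a `κ`-expression. -/
def HasExpr (κ : ℕ) {V : Type} (G : SimpleGraph V) (l : V → Fin κ) : Prop :=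
  ∃ (W : Type) (G' : SimpleGraph W) (l' : W → Fin κ), KGraph κ G' l' ∧
    ∃ e : G' ≃g G, ∀ w, l (e w) = l' w

namespace HasExpr

variable {κ : ℕ} {V W : Type} {G : SimpleGraph V} {l : V → Fin κ}

theorem iso (h : HasExpr κ G l) {G' : SimpleGraph W} {l' : W → Fin κ} (e : G ≃g G')
    (hl : ∀ v, l' (e v) = l v) : HasExpr κ G' l' := by
  obtain ⟨U, K, m, hK, f, hf⟩ := h
  exact ⟨U, K, m, hK, f.trans e, fun w => (hl _).trans (hf w)⟩

theorem union (h : HasExpr κ G l) {G' : SimpleGraph W} {l' : W → Fin κ} (h' : HasExpr κ G' l') :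
    HasExpr κ (SimpleGraph.sum G G') (Sum.elim l l') := by
  obtain ⟨U, K, m, hK, f, hf⟩ := h
  obtain ⟨U', K', m', hK', f', hf'⟩ := h'
  refine ⟨_, _, _, hK.union hK', ⟨Equiv.sumCongr f.toEquiv f'.toEquiv, ?_⟩, ?_⟩
  · rintro (a | a) (b | b)
    · simpa using f.map_adj_iff
    · simp
    · simp
    · simpa using f'.map_adj_iff
  · rintro (a | a)
    · exact hf a
    · exact hf' a

theorem relabel (h : HasExpr κ G l) (i j : Fin κ) :
    HasExpr κ G fun v => if l v = i then j else l v := by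
  obtain ⟨U, K, m, hK, f, hf⟩ := h
  exact ⟨U, K, _, hK.relabel i j, f, fun w => by simp [hf]⟩

theorem join (h : HasExpr κ G l) {i j : Fin κ} (hij : i ≠ j) :
    HasExpr κ (G ⊔ SimpleGraph.fromRel fun u v => l u = i ∧ l v = j) l := by
  obtain ⟨U, K, m, hK, f, hf⟩ := h
  refine ⟨U, _, m, hK.join i j hij, ⟨f.toEquiv, ?_⟩, hf⟩
  intro a b
  have h₁ : G.Adj (f a) (f b) ↔ K.Adj a b := f.map_adj_iff
  simp [hf, h₁, SimpleGraph.fromRel_adj]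

/-- All joins for the pairs of labels in `S`. -/
theorem joins (h : HasExpr κ G l) (S : Finset (Fin κ × Fin κ)) (hS : ∀ p ∈ S, p.1 ≠ p.2) :
    HasExpr κ (G ⊔ SimpleGraph.fromRel fun u v => (l u, l v) ∈ S) l := by
  induction S using Finset.induction_on with
  | empty =>
    have : SimpleGraph.fromRel (fun u v => (l u, l v) ∈ (∅ : Finset (Fin κ × Fin κ))) = ⊥ := by
      ext u v; simp
    rwa [this, sup_bot_eq]
  | insert p S hp ih =>
    have h₁ := (ih fun q hq => hS q (Finset.mem_insert_of_mem hq)).join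
      (hS p (Finset.mem_insert_self p S))
    convert h₁ using 1
    ext u v
    simp only [SimpleGraph.sup_adj, SimpleGraph.fromRel_adj, Finset.mem_insert, Prod.ext_iff]
    tauto

/-- Relabelling by an idempotent map. -/
theorem map (h : HasExpr κ G l) (f : Fin κ → Fin κ) (hf : ∀ i, f (f i) = f i) :
    HasExpr κ G fun v => f (l v) := by
  have key : ∀ S : Finset (Fin κ), HasExpr κ G fun v => if l v ∈ S then f (l v) else l v := by
    intro S
    induction S using Finset.induction_on with
    | empty => simpa using h
    | insert i S hi ih =>
      -- Idempotence makes relabelling one label at a time harmless: if a vertex has already been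
      -- moved to `i`, then `f i = i`.
      convert ih.relabel i (f i) using 2 with v
      by_cases hS : l v ∈ S
      · rw [if_pos (Finset.mem_insert_of_mem hS), if_pos hS]
        split_ifs with he
        · rw [← he, hf]
        · rfl
      · rw [if_neg hS]
        by_cases he : l v = i
        · simp [he]
        · simp [he, hS]
  simpa using key Finset.univ

theorem discrete (n : ℕ) (l : Fin (n + 1) → Fin κ) : HasExpr κ ⊥ l := by
  induction n with
  | zero =>
    refine ⟨Unit, ⊥, _, .single (l 0), ⟨(Equiv.equivPUnit (Fin 1)).symm, by simp⟩, fun w => ?_⟩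
    congr 1
  | succ n ih =>
    have h : HasExpr κ (⊥ : SimpleGraph (Fin 1)) fun _ => l (Fin.last _) :=
      ⟨Unit, ⊥, _, .single _, ⟨(Equiv.equivPUnit (Fin 1)).symm, by simp⟩, fun w => rfl⟩
    refine ((ih fun i => l i.castSucc).union h).iso ⟨finSumFinEquiv, ?_⟩ ?_
    · rintro (a | a) (b | b) <;> simp
    · rintro (a | a)
      · rfl
      · simp [Subsingleton.elim a 0]; rfl

/-- When all labels are distinct, a join adds a single edge, so every graph arises from isolated
vertices. -/
theorem of_injective {n : ℕ} (K : SimpleGraph (Fin (n + 1))) (l : Fin (n + 1) → Fin κ)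
    (hl : Function.Injective l) : HasExpr κ K l := by
  classical
  refine ((discrete n l).joins (Finset.univ.filter fun p => ∃ u v, p = (l u, l v) ∧ K.Adj u v)
    ?_).iso ⟨Equiv.refl _, ?_⟩ fun _ => rfl
  · rintro _ hp
    obtain ⟨u, v, rfl, h⟩ := (Finset.mem_filter.1 hp).2
    exact fun e => h.ne (hl e)
  · intro u v
    have hiff : ∀ u v, (∃ u' v', (l u, l v) = (l u', l v') ∧ K.Adj u' v') ↔ K.Adj u v := by
      refine fun u v => ⟨?_, fun h => ⟨u, v, rfl, h⟩⟩
      rintro ⟨u', v', e, h⟩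
      rw [Prod.mk.injEq] at e
      rwa [hl e.1, hl e.2]
    simp only [Equiv.refl_apply, SimpleGraph.sup_adj, SimpleGraph.bot_adj,
      SimpleGraph.fromRel_adj, Finset.mem_filter, Finset.mem_univ, true_and, hiff, false_or]
    exact ⟨fun h => ⟨h.ne, .inl h⟩, fun h => h.2.elim id fun h => h.symm⟩

theorem cliqueWidth_le (h : HasExpr κ G l) : cliqueWidth G ≤ κ := by
  obtain ⟨U, K, m, hK, f, -⟩ := h
  exact Nat.sInf_le ⟨U, K, m, hK, ⟨f⟩⟩

end HasExpr

theorem KGraph.nonempty {κ : ℕ} {V : Type} {G : SimpleGraph V} {l : V → Fin κ}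
    (h : KGraph κ G l) : Nonempty V := by
  induction h with
  | single i => infer_instance
  | union h₁ h₂ ih₁ ih₂ => infer_instance
  | relabel i j h ih => exact ih
  | join i j hij h ih => exact ih

theorem cliqueWidth_eq_zero_of_isEmpty {V : Type} [IsEmpty V] (G : SimpleGraph V) :
    cliqueWidth G = 0 := by
  rw [cliqueWidth, Nat.sInf_eq_zero]
  refine .inr (Set.eq_empty_of_forall_notMem ?_)
  rintro κ ⟨W, G', l, h, ⟨e⟩⟩
  obtain ⟨w⟩ := h.nonempty
  exact isEmptyElim (e w)

theorem cliqueWidth_congr {V W : Type} {G : SimpleGraph V} {G' : SimpleGraph W} (e : G ≃g G') :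
    cliqueWidth G = cliqueWidth G' := by
  unfold cliqueWidth
  congr 1
  ext κ
  exact ⟨fun ⟨U, K, m, hK, ⟨f⟩⟩ => ⟨U, K, m, hK, ⟨f.trans e⟩⟩,
    fun ⟨U, K, m, hK, ⟨f⟩⟩ => ⟨U, K, m, hK, ⟨f.trans e.symm⟩⟩⟩

/-- Copies of the graph `K` on `Fin g`, where a vertex `j` of a copy `t` and a vertex `j'` of an
earlier copy `t'` are adjacent if `R t j t' j'`. -/
def copies {g : ℕ} (K : SimpleGraph (Fin g)) (R : ℕ → Fin g → ℕ → Fin g → Prop) (L : ℕ) :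
    SimpleGraph (Fin L × Fin g) where
  Adj u v := (u.1 = v.1 ∧ K.Adj u.2 v.2) ∨ (v.1 < u.1 ∧ R u.1 u.2 v.1 v.2) ∨
    (u.1 < v.1 ∧ R v.1 v.2 u.1 u.2)
  symm := ⟨fun u v h => by
    rcases h with h | h | h
    · exact .inl ⟨h.1.symm, h.2.symm⟩
    · exact .inr (.inr h)
    · exact .inr (.inl h)⟩
  loopless := ⟨fun u h => by simp at h⟩

/-- If the adjacency of a vertex to the earlier copies depends only on the labels of the latter, then
the copies have an expression with labels for those and for the vertices of one gadget. -/
theorem hasExpr_copies {g a κ : ℕ} (K : SimpleGraph (Fin (g + 1)))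
    (R : ℕ → Fin (g + 1) → ℕ → Fin (g + 1) → Prop) (lab : ℕ → Fin (g + 1) → Fin a)
    (A : ℕ → Fin (g + 1) → Fin a → Prop) (hR : ∀ t j t' j', R t j t' j' ↔ A t j (lab t' j'))
    (hκ : κ = a + (g + 1)) (L : ℕ) :
    HasExpr κ (copies K R (L + 1)) fun u => Fin.cast hκ.symm (Fin.castAdd (g + 1) (lab u.1 u.2)) := by
  classical
  subst hκ
  simp only [Fin.cast_refl, id]
  have hnew : HasExpr (a + (g + 1)) K fun j => Fin.natAdd a j :=
    HasExpr.of_injective K _ fun i j h => by simpa using h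
  -- The upper `g + 1` labels are reserved for the newest copy, whose vertices carry distinct ones.
  -- Once its edges to earlier copies are in place, `f t` moves them to the lower labels and frees
  -- the upper ones.
  set f : ℕ → Fin (a + (g + 1)) → Fin (a + (g + 1)) := fun t =>
    Fin.addCases (fun i => Fin.castAdd (g + 1) i) fun j => Fin.castAdd (g + 1) (lab t j) with hf
  have hf₁ : ∀ t i, f t (Fin.castAdd (g + 1) i) = Fin.castAdd (g + 1) i := fun t i => by
    simp [hf]
  have hf₂ : ∀ t j, f t (Fin.natAdd a j) = Fin.castAdd (g + 1) (lab t j) := fun t j => by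
    simp [hf]
  have hff : ∀ t i, f t (f t i) = f t i := fun t i => by
    refine Fin.addCases (fun i => ?_) (fun j => ?_) i
    · rw [hf₁, hf₁]
    · rw [hf₂, hf₁]
  induction L with
  | zero =>
    refine (hnew.map (f 0) (hff 0)).iso ⟨⟨fun j => (0, j), fun u => u.2, fun _ => rfl,
      fun u => Prod.ext (Fin.ext (by have := u.1.2; change 0 = u.1.val; lia)) rfl⟩, ?_⟩ fun j => ?_
    · intro u v
      simp [copies]
    · simp [hf₂]
  | succ L ih =>
    let S : Finset (Fin (a + (g + 1)) × Fin (a + (g + 1))) := Finset.univ.filter fun p =>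
      ∃ i j, p = (Fin.castAdd (g + 1) i, Fin.natAdd a j) ∧ A (L + 1) j i
    have hS : ∀ p ∈ S, p.1 ≠ p.2 := by
      rintro _ hp
      obtain ⟨i, j, rfl, -⟩ := (Finset.mem_filter.1 hp).2
      intro e
      have := congrArg Fin.val e
      have := i.2
      simp at this
      simp at *
      lia
    have hS₁ : ∀ i j, (Fin.castAdd (g + 1) i, Fin.natAdd a j) ∈ S ↔ A (L + 1) j i := by
      intro i j
      refine ⟨fun h => ?_, fun h => Finset.mem_filter.2 ⟨Finset.mem_univ _, i, j, rfl, h⟩⟩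
      obtain ⟨i', j', e, h⟩ := (Finset.mem_filter.1 h).2
      rw [Prod.mk.injEq] at e
      rwa [Fin.castAdd_injective _ _ e.1, Fin.natAdd_injective _ _ e.2]
    have hS₂ : ∀ i p, (p, Fin.castAdd (g + 1) i) ∉ S := by
      intro i p h
      obtain ⟨i', j', e, -⟩ := (Finset.mem_filter.1 h).2
      rw [Prod.mk.injEq] at e
      have := congrArg Fin.val e.2
      have := i.2
      simp at *
      lia
    have hS₃ : ∀ j p, (Fin.natAdd a j, p) ∉ S := by
      intro j p h
      obtain ⟨i', j', e, -⟩ := (Finset.mem_filter.1 h).2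
      rw [Prod.mk.injEq] at e
      have := congrArg Fin.val e.1
      have := i'.2
      simp at *
      lia
    let e : (Fin (L + 1) × Fin (g + 1)) ⊕ Fin (g + 1) ≃ Fin (L + 1 + 1) × Fin (g + 1) :=
      Equiv.ofBijective (Sum.elim (fun u => (u.1.castSucc, u.2)) fun j => (Fin.last _, j)) <| by
        constructor
        · rintro (⟨t, j⟩ | j) (⟨t', j'⟩ | j') h
          · simpa using h
          · exact absurd (congrArg Prod.fst h) (Fin.castSucc_lt_last t).ne
          · exact absurd (congrArg Prod.fst h) (Fin.castSucc_lt_last t').ne'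
          · simpa using h
        · rintro ⟨t, j⟩
          refine Fin.lastCases ⟨.inr j, rfl⟩ (fun t => ⟨.inl (t, j), rfl⟩) t
    have he₁ : ∀ u, e (.inl u) = (u.1.castSucc, u.2) := fun _ => rfl
    have he₂ : ∀ j, e (.inr j) = (Fin.last _, j) := fun _ => rfl
    refine (((ih.union hnew).joins S hS).map (f (L + 1)) (hff _)).iso ⟨e, ?_⟩ ?_
    · have hlt : ∀ t : Fin (L + 1), ¬ Fin.last (L + 1) < t.castSucc := fun t =>
        (Fin.castSucc_lt_last t).not_gt
      rintro (⟨t, j⟩ | j) (⟨t', j'⟩ | j')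
      · simp [he₁, copies, hS₂]
      · simp [he₁, he₂, copies, hS₃, hS₁, hR, hlt, Fin.castSucc_lt_last, (Fin.castSucc_lt_last t).ne]
      · simp [he₁, he₂, copies, hS₃, hS₁, hR, hlt, Fin.castSucc_lt_last,
          (Fin.castSucc_lt_last t').ne']
      · simp [he₂, copies, hS₃]
    · rintro (⟨t, j⟩ | j)
      · simp [he₁, hf₁]
      · simp [he₂, hf₂]

theorem cliqueWidth_copies_le {g a : ℕ} (K : SimpleGraph (Fin g))
    (R : ℕ → Fin g → ℕ → Fin g → Prop) (lab : ℕ → Fin g → Fin a)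
    (A : ℕ → Fin g → Fin a → Prop) (hR : ∀ t j t' j', R t j t' j' ↔ A t j (lab t' j'))
    (L : ℕ) : cliqueWidth (copies K R L) ≤ a + g := by
  rcases L with _ | L
  · rw [cliqueWidth_eq_zero_of_isEmpty]; exact Nat.zero_le _
  rcases g with _ | g
  · rw [cliqueWidth_eq_zero_of_isEmpty]; exact Nat.zero_le _
  exact (hasExpr_copies K R lab A hR rfl L).cliqueWidth_le

/-! ### Gadgets -/

/-- A gadget: a graph in which some vertices read and some write the value of a slot, and some are
pinned to vertices of the target, possibly under the condition that a slot has a certain type. -/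
structure Gadget (k p : ℕ) (V : Type) where
  g : ℕ
  graph : SimpleGraph (Fin g)
  reader : Fin g → Option (Fin k × Fin p)
  writer : Fin g → Option (Fin k × Fin p)
  cond : Fin g → Option (Fin k × ℕ)
  val : Fin g → Option V

namespace Gadget

variable {k p : ℕ} {V A Cl : Type}

/-- The partial map on the gadget when the slots have the types `θ`. -/
def pinned (γ : Gadget k p V) (θ : ℕ → ℕ) (j : Fin γ.g) : Option V :=
  (γ.cond j).elim (γ.val j) fun c => if θ c.1 = c.2 then γ.val j else none

/-- A vertex of copy `t` reads what a vertex of copy `t'` has written. -/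
def Reads (γ : Gadget k p V) (blk : ℕ → ℕ → ℕ) (t : ℕ) (j : Fin γ.g) (t' : ℕ) (j' : Fin γ.g) :
    Prop :=
  ∃ l l' e, γ.reader j = some (l, e) ∧ γ.writer j' = some (l', e) ∧ blk l t = blk l' t'

/-- The gadget forces the slots to contain values of which one satisfies the type of its slot. The
value `c` is represented by the sets `S c e`: it is read by vertices whose colours form this set, and
written by vertices with this common neighbourhood. -/
structure Implements (γ : Gadget k p V) (H : LoopGraph V) (P : LoopGraph A) (pr : V → A)
    (D : ℕ) (sat : Cl → ℕ → Prop) (S : Cl → Fin p → Set A) : Prop where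
  sound : ∀ (θ : ℕ → ℕ) (f : Fin γ.g → V), (∀ l < k, θ l < D) →
    (∀ j j', γ.graph.Adj j j' → H.Adj (f j) (f j')) →
    (∀ j, ∀ v ∈ γ.pinned θ j, f j = v) →
    ∃ c : Fin k → Cl, (∃ l : Fin k, sat (c l) (θ l)) ∧
      (∀ l e, ∀ x ∈ S (c l) e, ∃ j, γ.reader j = some (l, e) ∧ pr (f j) = x) ∧
      ∀ l e x, (∀ j, γ.writer j = some (l, e) → P.Adj x (pr (f j))) → x ∈ S (c l) e
  complete : ∃ F : (Fin k → Cl) → Fin k → Fin γ.g → V,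
    (∀ c m j j', γ.graph.Adj j j' → H.Adj (F c m j) (F c m j')) ∧
    (∀ c m θ, sat (c m) (θ m) → ∀ j, ∀ v ∈ γ.pinned θ j, F c m j = v) ∧
    ∀ c m c' m' l l' e j j', γ.reader j = some (l, e) → γ.writer j' = some (l', e) →
      c l = c' l' → H.Adj (F c m j) (F c' m' j')

/-- Among more than `|α|` successive subsets that get smaller, two are equal. -/
theorem exists_succ_eq_of_antitone {α : Type} [Fintype α] (Z : ℕ → Finset α) (hZ : Antitone Z)
    {R : ℕ} (hR : Fintype.card α < R) : ∃ r < R, Z (r + 1) = Z r := by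
  by_contra! h
  have key : ∀ r ≤ R, (Z r).card + r ≤ Fintype.card α := by
    intro r
    induction r with
    | zero => intro _; simpa using Finset.card_le_univ _
    | succ r ih =>
      intro hr
      have := Finset.card_lt_card ((hZ (Nat.le_succ r)).lt_of_ne (h r (by lia)))
      have := ih (by lia)
      simp only [Nat.succ_eq_add_one] at *
      lia
  have := key R le_rfl
  lia

/-- Later readers see earlier writers, so the sets claimed for a block shrink along the copies. `Z
r` consists of the triples (block, e, x) such that x lies in the e-th set of every occurrence of the
block in the first r rounds. By `hR` some round has `Z (r + 1) = Z r`. There each occurrence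
contains the slice of `Z (r + 1)` and is contained in that of `Z r`, so it depends on the block
alone; this also covers two slots of one clause, although a copy does not read itself. By `hS` equal
sets mean equal values. Conversely, every copy follows the assignment and points to a slot that it
satisfies. -/
theorem Implements.exists_hom_iff [Nonempty Cl] [Fintype A] {γ : Gadget k p V} {H : LoopGraph V}
    {P : LoopGraph A} {pr : V → A} {D : ℕ} {sat : Cl → ℕ → Prop} {S : Cl → Fin p → Set A}
    (h : γ.Implements H P pr D sat S) (hpr : ∀ u v, H.Adj u v → P.Adj (pr u) (pr v))
    (hS : ∀ c c', S c = S c' → c = c')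
    {blk ty : ℕ → ℕ → ℕ} {C R nb : ℕ} (hblk : ∀ l x, blk l x = blk l (x % C))
    (hty : ∀ l x, ty l x = ty l (x % C)) (hnb : ∀ l < k, ∀ x < C, blk l x < nb)
    (hD : ∀ l < k, ∀ x < C, ty l x < D)
    (hR : nb * (p * Fintype.card A) < R) :
    (∃ f : Fin (R * C) × Fin γ.g → V,
      (∀ u v, (copies γ.graph (γ.Reads blk) (R * C)).Adj u v → H.Adj (f u) (f v)) ∧
      ∀ u, ∀ v ∈ γ.pinned (fun l => ty l u.1) u.2, f u = v) ↔
    ∃ a : ℕ → Cl, ∀ x < C, ∃ l : Fin k, sat (a (blk l x)) (ty l x) := by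
  classical
  constructor
  · rintro ⟨f, hf, hpin⟩
    rcases Nat.eq_zero_or_pos C with rfl | hC
    · exact ⟨fun _ => Classical.arbitrary _, fun x hx => by lia⟩
    have hsound : ∀ t : ℕ, ∃ c : Fin k → Cl, ∀ ht : t < R * C,
        (∃ l : Fin k, sat (c l) (ty l t)) ∧
        (∀ l e, ∀ x ∈ S (c l) e, ∃ j, γ.reader j = some (l, e) ∧ pr (f (⟨t, ht⟩, j)) = x) ∧
        ∀ l e x, (∀ j, γ.writer j = some (l, e) → P.Adj x (pr (f (⟨t, ht⟩, j)))) →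
          x ∈ S (c l) e := by
      intro t
      by_cases ht : t < R * C
      · obtain ⟨c, hc⟩ := h.sound (fun l => ty l t) (fun j => f (⟨t, ht⟩, j))
          (fun l hl => by rw [hty]; exact hD l hl _ (Nat.mod_lt _ hC))
          (fun j j' hj => hf _ _ (.inl ⟨rfl, hj⟩)) (fun j v hv => hpin (⟨t, ht⟩, j) v hv)
        exact ⟨c, fun _ => hc⟩
      · exact ⟨fun _ => Classical.arbitrary _, fun ht' => absurd ht' ht⟩
    choose c hc using hsound
    have hmono : ∀ t' t, t' < t → t < R * C → ∀ (l l' : Fin k) (e : Fin p), blk l t = blk l' t' →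
        S (c t l) e ⊆ S (c t' l') e := by
      intro t' t htt ht l l' e hb x hx
      obtain ⟨j, hj, rfl⟩ := (hc t ht).2.1 l e x hx
      exact (hc t' (htt.trans ht)).2.2 l' e _ fun j' hj' =>
        hpr _ _ (hf _ _ (.inr (.inl ⟨htt, l, l', e, hj, hj', hb⟩)))
    let Z : ℕ → Finset (Fin nb × Fin p × A) := fun r => Finset.univ.filter fun z =>
      ∀ t' < r * C, ∀ l : Fin k, blk l t' = z.1 → z.2.2 ∈ S (c t' l) z.2.1
    have hZ : Antitone Z := fun r r' hr z hz => by
      simp only [Z, Finset.mem_filter, Finset.mem_univ, true_and] at hz ⊢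
      exact fun t' ht' => hz t' (ht'.trans_le (Nat.mul_le_mul_right C hr))
    obtain ⟨r, hr, hrZ⟩ := exists_succ_eq_of_antitone Z hZ (R := R) (by simpa using hR)
    have hlt : ∀ x < C, r * C + x < (r + 1) * C := fun x hx => by rw [add_mul]; lia
    have hlt' : ∀ x < C, r * C + x < R * C := fun x hx =>
      (hlt x hx).trans_le (Nat.mul_le_mul_right C hr)
    have hmod : ∀ x < C, (r * C + x) % C = x := fun x hx => by
      rw [mul_comm, Nat.mul_add_mod, Nat.mod_eq_of_lt hx]
    have hbx : ∀ l, ∀ x < C, blk l (r * C + x) = blk l x := fun l x hx => by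
      rw [hblk, hmod x hx]
    have hkey : ∀ x < C, ∀ (l : Fin k) e a (hb : blk l x < nb),
        a ∈ S (c (r * C + x) l) e ↔ (⟨blk l x, hb⟩, e, a) ∈ Z r := by
      intro x hx l e a hb
      constructor
      · intro ha
        refine Finset.mem_filter.2 ⟨Finset.mem_univ _, fun t' ht' l' hl' => ?_⟩
        exact hmono t' (r * C + x) (by lia) (hlt' x hx) l l' e
          (by rw [hbx l x hx]; exact hl'.symm) ha
      · intro ha
        rw [← hrZ] at ha
        exact (Finset.mem_filter.1 ha).2 _ (hlt x hx) l (hbx l x hx)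
    have huniq : ∀ x < C, ∀ x' < C, ∀ l l' : Fin k, blk l x = blk l' x' →
        c (r * C + x) l = c (r * C + x') l' := by
      intro x hx x' hx' l l' hb
      refine hS _ _ (funext fun e => Set.ext fun a => ?_)
      rw [hkey x hx l e a (hnb l l.2 x hx), hkey x' hx' l' e a (hnb l' l'.2 x' hx')]
      simp only [hb]
    -- Blocks that occur in no clause receive an arbitrary value.
    refine ⟨fun b => if hb : ∃ x, ∃ l : Fin k, x < C ∧ blk l x = b then
      c (r * C + hb.choose) hb.choose_spec.choose else Classical.arbitrary _, fun x hx => ?_⟩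
    obtain ⟨l, hl⟩ := (hc _ (hlt' x hx)).1
    refine ⟨l, ?_⟩
    have hb : ∃ x', ∃ l' : Fin k, x' < C ∧ blk l' x' = blk l x := ⟨x, l, hx, rfl⟩
    beta_reduce
    rw [dif_pos hb, huniq _ hb.choose_spec.choose_spec.1 x hx _ l hb.choose_spec.choose_spec.2]
    rwa [hty, hmod x hx] at hl
  · rintro ⟨a, ha⟩
    obtain ⟨F, hF₁, hF₂, hF₃⟩ := h.complete
    have hC : ∀ t : Fin (R * C), 0 < C := fun t => by
      rcases Nat.eq_zero_or_pos C with rfl | hC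
      · have := t.2; simp at this
      · exact hC
    have hm : ∀ t : Fin (R * C), ∃ l : Fin k, sat (a (blk l t)) (ty l t) := fun t => by
      obtain ⟨l, hl⟩ := ha (t % C) (Nat.mod_lt _ (hC t))
      exact ⟨l, by rwa [hblk, hty]⟩
    choose m hm using hm
    refine ⟨fun u => F (fun l => a (blk l u.1)) (m u.1) u.2, ?_, fun u v hv =>
      hF₂ _ _ (fun l => ty l u.1) (hm u.1) u.2 v hv⟩
    rintro ⟨t, j⟩ ⟨t', j'⟩ (⟨e, hj⟩ | ⟨-, l, l', e, hj, hj', hb⟩ | ⟨-, l, l', e, hj, hj', hb⟩)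
    · simp only at e hj
      subst e
      exact hF₁ _ _ _ _ hj
    · exact hF₃ _ _ _ _ l l' e j j' hj hj' (by simp only [hb])
    · exact H.symm _ _ (hF₃ _ _ _ _ l l' e j' j hj hj' (by simp only [hb]))

end Gadget

/-! ### Gadgets from projectivity -/

namespace LoopGraph

variable {A B V : Type} {P : LoopGraph A} {W : LoopGraph B}

/-- `P × W` is `P`-projective, for powers of `P` with an arbitrary finite non-empty index set. -/
def ProjectiveWith (P : LoopGraph A) (W : LoopGraph B) : Prop :=
  ∀ (Q : Type) [Finite Q] [Nonempty Q] (f : (Q → A) × B → A),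
    (∀ u v, ((pi fun _ : Q => P).prod W).Adj u v → P.Adj (f u) (f v)) →
    (∀ x y, f (fun _ => x, y) = x) → ∃ q, ∀ z, f z = z.1 q

/-- The definition covers exponents from two on. For a one-element index set every tuple is
constant, so idempotence alone gives the projection. -/
theorem IsProjectiveAt.projectiveWith {m : ℕ} {U : Fin m → Type} {F : ∀ j, LoopGraph (U j)}
    {i : Fin m} (h : IsProjectiveAt F i) :
    (F i).ProjectiveWith (pi fun j : {j : Fin m // j ≠ i} => F j) := by
  intro Q _ _ f hf hid
  obtain ⟨ℓ, ⟨e⟩⟩ := Finite.exists_equiv_fin Q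
  by_cases hℓ : 2 ≤ ℓ
  · obtain ⟨q, hq⟩ := h.2 ℓ hℓ ⟨fun z => f (fun q => z.1 (e q), z.2), fun {u v} huv =>
      hf _ _ ⟨fun q => huv.1 (e q), huv.2⟩⟩ fun x y => hid x y
    refine ⟨e.symm q, fun z => ?_⟩
    have := hq (fun r => z.1 (e.symm r), z.2)
    simpa using this
  · have : Subsingleton (Fin ℓ) := Fin.subsingleton_iff_le_one.2 (by lia)
    have : Subsingleton Q := e.subsingleton
    obtain ⟨q⟩ := ‹Nonempty Q›
    refine ⟨q, fun z => ?_⟩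
    rw [← hid (z.1 q) z.2]
    congr 1
    exact Prod.ext (funext fun r => congrArg z.1 (Subsingleton.elim r q)) rfl

/-- Projectivity for blow-ups of `P ^ Q × W`, in which vertices are replaced by several copies. -/
theorem ProjectiveWith.exists_eq {Q J : Type} [Finite Q] [Nonempty Q] [Nontrivial A]
    (h : P.ProjectiveWith W) (π : J → (Q → A) × B) (ι : (Q → A) × B → J) (hι : ∀ x, π (ι x) = x)
    (good : Set J) (hgood : ∀ x, ι x ∈ good) (f : J → A)
    (hf : ∀ j j', ((pi fun _ : Q => P).prod W).Adj (π j) (π j') → P.Adj (f j) (f j'))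
    (hid : ∀ j ∈ good, ∀ x, (π j).1 = (fun _ => x) → f j = x) :
    ∃ q, ∀ j ∈ good, f j = (π j).1 q := by
  classical
  obtain ⟨q, hq⟩ := h Q (fun x => f (ι x)) (fun u v huv => hf _ _ (by rwa [hι, hι]))
    fun x y => hid _ (hgood _) x (by rw [hι])
  refine ⟨q, fun j hj => ?_⟩
  have hs : ∀ x, π (if x = π j then j else ι x) = x := fun x => by
    split_ifs with hx
    exacts [hx.symm, hι x]
  -- Changing the section at the single point `π j` yields a projection to some `q'`, which agrees
  -- with that to `q` away from `π j`. If `q ≠ q'`, consider the vector with `a` at `q` and `b`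
  -- elsewhere, and the one with the roles exchanged: one of them differs from `π j` and separates
  -- `q` from `q'`.
  obtain ⟨q', hq'⟩ := h Q (fun x => f (if x = π j then j else ι x))
    (fun u v huv => hf _ _ (by rwa [hs, hs])) fun x y => hid _ (by
      split_ifs
      exacts [hj, hgood _]) x (by rw [hs])
  have hj' := hq' (π j)
  rw [if_pos rfl] at hj'
  rw [hj']
  by_cases hqq : q = q'
  · rw [hqq]
  exfalso
  obtain ⟨a, b, hab⟩ := exists_pair_ne A
  have key : ∀ v : (Q → A) × B, v ≠ π j → v.1 q = v.1 q' := fun v hv => by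
    rw [← hq, ← hq', if_neg hv]
  by_cases h₁ : (fun r => if r = q then a else b, (π j).2) = π j
  · have := key (fun r => if r = q then b else a, (π j).2) (by
      rw [← h₁]
      intro e
      have := congrFun (congrArg Prod.fst e) q
      simp at this
      exact hab this.symm)
    simp [Ne.symm hqq] at this
    exact hab this.symm
  · have := key _ h₁
    simp [Ne.symm hqq] at this
    exact hab this

/-- Both enumerations run over all of `A`, with repetitions. Thus every signature set has equally
many readers and writers, and one vertex of a power of `P` can serve a different set in each
coordinate. -/
theorem exists_range_eq [Finite A] {S : Set A} (hS : S ∈ P.signatureSets) :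
    ∃ rd wr : A → A, Set.range rd = S ∧ P.commonNbrs (Set.range wr) = S := by
  have key : ∀ T : Set A, T.Nonempty → ∃ f : A → A, Set.range f = T := by
    classical
    rintro T ⟨t, ht⟩
    refine ⟨fun x => if x ∈ T then x else t, Set.ext fun x => ⟨?_, fun hx => ⟨x, if_pos hx⟩⟩⟩
    rintro ⟨y, rfl⟩
    simp only
    split_ifs with h
    exacts [h, ht]
  obtain ⟨hne, T, hT, rfl⟩ := hS
  obtain ⟨rd, hrd⟩ := key _ hne
  obtain ⟨wr, hwr⟩ := key _ hT
  exact ⟨rd, wr, hrd, by rw [hwr]⟩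

/-- The ways to satisfy a clause: the values of the slots, and a slot to be satisfied. -/
abbrev Claim (k : ℕ) (Cl : Type) : Type := (Fin k → Cl) × Option (Fin k)

/-- The vertices of the gadget: those of `P ^ Q × W`, the readers (`true`) and writers (`false`), and
vertices that check the types of the slots. -/
abbrev GadgetVertex (k p D : ℕ) (A B Cl : Type) : Type :=
  ((Claim k Cl → A) × B) ⊕ ((Bool × Fin k × Fin p × A) ⊕ Option (Fin k × Fin D))

/-- A vertex is a vector indexed by claims. In coordinate q a reader shows an element of the set
claimed by q, and a writer a member of a set with that common neighbourhood. The check vertex for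
slot l and type t has `b` at the claims that point to l although their value does not satisfy t, and
`a` elsewhere; it is pinned over `a` if the slot has type t. Claims with `none` keep the index set
non-empty for `k = 0`, and an unconditionally pinned check vertex excludes them. -/
theorem ProjectiveWith.exists_gadget {k p D : ℕ} {Cl : Type} [Finite A] [Finite B] [Finite Cl]
    [Nonempty Cl] (h : P.ProjectiveWith W) {H : LoopGraph V} (φ : Iso H (P.prod W))
    (hloop : ∀ x, ¬ P.Adj x x) {a b : A} (hab : P.Adj a b) {y₀ y₁ : B} (hy : W.Adj y₀ y₁)
    (sat : Cl → ℕ → Prop) (S : Cl → Fin p → Set A) (hS : ∀ c e, S c e ∈ P.signatureSets) :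
    ∃ γ : Gadget k p V, γ.Implements H P (fun v => (φ v).1) D sat S := by
  classical
  have hne : a ≠ b := fun e => hloop b (e ▸ hab)
  have : Nontrivial A := ⟨a, b, hne⟩
  choose rd wr hrd hwr using fun c e => exists_range_eq (hS c e)
  let π : GadgetVertex k p D A B Cl → (Claim k Cl → A) × B := Sum.elim id (Sum.elim
    (fun s => (fun q => if s.1 then rd (q.1 s.2.1) s.2.2.1 s.2.2.2 else wr (q.1 s.2.1) s.2.2.1 s.2.2.2,
      if s.1 then y₀ else y₁))
    (fun s => (fun q => s.elim (if q.2 = none then b else a) fun s =>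
      if q.2 = some s.1 ∧ ¬ sat (q.1 s.1) s.2 then b else a, y₀)))
  let G : LoopGraph ((Claim k Cl → A) × B) := (pi fun _ : Claim k Cl => P).prod W
  obtain ⟨g, ⟨ε⟩⟩ := Finite.exists_equiv_fin (GadgetVertex k p D A B Cl)
  let K : SimpleGraph (Fin g) :=
    { Adj := fun j j' => G.Adj (π (ε.symm j)) (π (ε.symm j'))
      symm := ⟨fun j j' hj => G.symm _ _ hj⟩
      loopless := ⟨fun j hj => hloop _ (hj.1 (Classical.arbitrary (Claim k Cl)))⟩ }
  let slot (β : Bool) : GadgetVertex k p D A B Cl → Option (Fin k × Fin p) := Sum.elim (fun _ => none)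
    (Sum.elim (fun s => if s.1 = β then some (s.2.1, s.2.2.1) else none) fun _ => none)
  have hslot : ∀ β j l e, slot β j = some (l, e) ↔ ∃ x, j = .inr (.inl (β, l, e, x)) := by
    intro β j l e
    rcases j with j | ⟨β', l', e', x⟩ | j
    · simp [slot]
    · by_cases hβ : β' = β <;> simp [slot, hβ]
    · simp [slot]
  let cond : GadgetVertex k p D A B Cl → Option (Fin k × ℕ) := Sum.elim (fun _ => none)
    (Sum.elim (fun _ => none) fun s => s.map fun s => (s.1, (s.2 : ℕ)))
  let diag (j : GadgetVertex k p D A B Cl) : Option V := if ∃ x, (π j).1 = fun _ => x then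
    some (φ.symm ((π j).1 (Classical.arbitrary (Claim k Cl)), (π j).2)) else none
  let val : GadgetVertex k p D A B Cl → Option V := fun j => Sum.elim (fun _ => diag j)
    (Sum.elim (fun _ => diag j) fun _ => some (φ.symm (a, y₀))) j
  have hdiag : ∀ j x, (π j).1 = (fun _ => x) → diag j = some (φ.symm (x, (π j).2)) := by
    intro j x hx
    simp only [diag]
    rw [if_pos ⟨x, hx⟩, hx]
  let γ : Gadget k p V := ⟨g, K, fun j => slot true (ε.symm j), fun j => slot false (ε.symm j),
    fun j => cond (ε.symm j), fun j => val (ε.symm j)⟩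
  have hφ : ∀ u v, G.Adj (π u) (π v) → ∀ q, H.Adj (φ.symm ((π u).1 q, (π u).2))
      (φ.symm ((π v).1 q, (π v).2)) := fun u v huv q =>
    φ.symm.map_rel_iff.2 ⟨huv.1 q, huv.2⟩
  refine ⟨γ, ⟨fun θ f hθ hf hpin => ?_, ?_⟩⟩
  · have hadj : ∀ j j', G.Adj (π j) (π j') → P.Adj (φ (f (ε j))).1 (φ (f (ε j'))).1 :=
      fun j j' hj => (φ.map_rel_iff.2 (hf (ε j) (ε j') (by
        simpa [γ, K] using hj))).1
    have hpin' : ∀ j, cond j = none → ∀ v, val j = some v → f (ε j) = v := by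
      intro j hj v hv
      refine hpin (ε j) v ?_
      simp [Gadget.pinned, γ, hj, hv]
    obtain ⟨q, hq⟩ := h.exists_eq π Sum.inl (fun _ => rfl)
      {j | ∀ s, j ≠ .inr (.inr s)} (fun x s => by simp) (fun j => (φ (f (ε j))).1) hadj (by
        rintro (j | j | j) hj x hx
        · rw [hpin' (.inl j) rfl _ (hdiag (.inl j) x hx)]; simp
        · rw [hpin' (.inr (.inl j)) rfl _ (hdiag (.inr (.inl j)) x hx)]; simp
        · exact absurd rfl (hj j))
    -- Check vertices are pinned regardless of idempotence, so they lie outside the good set and are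
    -- controlled through a neighbour: the vector with `a` and `b` interchanged, over `y₁`. If
    -- coordinate `q` of the check vertex were `b`, that neighbour would be coloured `a`, next to
    -- the pinned `a`, and `P` has no loops.
    have hcheck : ∀ s, f (ε (.inr (.inr s))) = φ.symm (a, y₀) → (π (.inr (.inr s))).1 q ≠ b := by
      intro s hs hb
      have hz : ∀ r, (π (.inr (.inr s))).1 r = a ∨ (π (.inr (.inr s))).1 r = b := by
        intro r
        rcases s with _ | s
        · simp only [π, Sum.elim_inr, Option.elim_none]; split_ifs <;> simp
        · simp only [π, Sum.elim_inr, Option.elim_some]; split_ifs <;> simp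
      have := hadj (.inr (.inr s)) (.inl (fun r => if (π (.inr (.inr s))).1 r = a then b else a, y₁))
        ⟨fun r => by
          change P.Adj _ (if (π (.inr (.inr s))).1 r = a then b else a)
          rcases hz r with hr | hr
          · rw [if_pos hr, hr]; exact hab
          · rw [if_neg (by rw [hr]; exact hne.symm), hr]; exact P.symm _ _ hab, hy⟩
      rw [hs, hq (.inl _) (by simp)] at this
      simp only [RelIso.apply_symm_apply] at this
      change P.Adj a (if (π (.inr (.inr s))).1 q = a then b else a) at this
      rw [hb, if_neg hne.symm] at this
      exact hloop a this
    refine ⟨q.1, ?_, ?_, ?_⟩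
    · rcases hq2 : q.2 with _ | m
      · refine absurd ?_ (hcheck none (hpin' _ rfl _ rfl))
        simp [π, hq2]
      · refine ⟨m, ?_⟩
        by_contra hsat
        refine absurd ?_ (hcheck (some (m, ⟨θ m, hθ m m.2⟩)) (hpin _ _ ?_))
        · simp [π, hq2, hsat]
        · simp [Gadget.pinned, γ, cond, val]
    · intro l e x hx
      rw [← hrd] at hx
      obtain ⟨z, rfl⟩ := hx
      refine ⟨ε (.inr (.inl (true, l, e, z))), ?_, ?_⟩
      · simp [γ, hslot]
      · rw [hq _ (by simp)]
        simp [π]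
    · intro l e x hx
      rw [← hwr]
      rintro _ ⟨z, rfl⟩
      have := hx (ε (.inr (.inl (false, l, e, z)))) (by simp [γ, hslot])
      rw [hq _ (by simp)] at this
      exact P.symm _ _ (by simpa [π] using this)
  · refine ⟨fun c m j => φ.symm ((π (ε.symm j)).1 (c, some m), (π (ε.symm j)).2),
      fun c m j j' hj => hφ _ _ hj _, fun c m θ hsat j v hv => ?_, ?_⟩
    · have hd : ∀ j v, diag j = some v → φ.symm ((π j).1 (c, some m), (π j).2) = v := by
        intro j v hv
        by_cases hx : ∃ x, (π j).1 = fun _ => x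
        · obtain ⟨x, hx⟩ := hx
          rw [hdiag j x hx] at hv
          rw [hx]
          exact Option.some.inj hv
        · simp [diag, hx] at hv
      obtain ⟨j, rfl⟩ := ε.surjective j
      simp only [Gadget.pinned, γ, Equiv.symm_apply_apply] at hv ⊢
      rcases j with j | j | _ | ⟨l, t⟩
      · exact hd _ _ hv
      · exact hd _ _ hv
      · have : φ.symm (a, y₀) = v := by simpa [cond, val] using hv
        simpa [π] using this
      · have : θ l = t ∧ φ.symm (a, y₀) = v := by simpa [cond, val] using hv
        rw [← this.2]
        have hns : ¬ (m = l ∧ ¬ sat (c l) t) := by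
          rintro ⟨rfl, hn⟩
          rw [this.1] at hsat
          exact hn hsat
        simp only [π, Sum.elim_inr, Option.elim_some, Option.some.injEq]
        rw [if_neg hns]
    · intro c m c' m' l l' e j j' hj hj' hc
      obtain ⟨x, hx⟩ := (hslot _ _ _ _).1 hj
      obtain ⟨x', hx'⟩ := (hslot _ _ _ _).1 hj'
      refine φ.symm.map_rel_iff.2 ?_
      rw [hx, hx']
      simp only [π, Sum.elim_inr, Sum.elim_inl, if_true, hc]
      -- Readers lie over `y₀` and writers over `y₁`, so edges between copies are always respected
      -- in `W`.
      refine ⟨P.symm _ _ ?_, hy⟩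
      have : rd (c' l') e x ∈ P.commonNbrs (Set.range (wr (c' l') e)) := by
        rw [hwr, ← hrd]; exact ⟨x, rfl⟩
      simpa using this _ ⟨x', rfl⟩

end LoopGraph

/-! ### The instance made of copies: encoding, extensions, clique-width -/

namespace Gadget

variable {k p N : ℕ} {V : Type}

open Classical in
/-- The data of the gadget for the reduction program. -/
noncomputable def code (γ : Gadget k p V) (num : V ≃ Fin N) : GadgetCode k γ.g where
  adj j j' := if γ.graph.Adj j j' then 1 else 0
  link j j' := (γ.reader j).bind fun x => (γ.writer j').bind fun y =>
    if x.2 = y.2 then some (x.1, y.1) else none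
  cond := γ.cond
  val j := (γ.val j).elim 0 fun v => (num v : ℕ) + 1

/-- The instance that consists of `L` copies of the gadget. -/
def inst (γ : Gadget k p V) (blk ty : ℕ → ℕ → ℕ) (L : ℕ) : ExtInstance V where
  n := L * γ.g
  G := (copies γ.graph (γ.Reads blk) L).comap finProdFinEquiv.symm
  h u := γ.pinned (fun l => ty l (finProdFinEquiv.symm u).1) (finProdFinEquiv.symm u).2

variable (γ : Gadget k p V) (num : V ≃ Fin N) {blk ty : ℕ → ℕ → ℕ} {L : ℕ}

open Classical in
theorem cross_link (t t' : ℕ) (j j' : Fin γ.g) :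
    GadgetCode.cross blk ((γ.code num).link j j') t t' =
      if γ.Reads blk t j t' j' then 1 else 0 := by
  have key : ∀ x y : Option (Fin k × Fin p), GadgetCode.cross blk (x.bind fun x => y.bind fun y =>
      if x.2 = y.2 then some (x.1, y.1) else none) t t' =
      if ∃ l l' e, x = some (l, e) ∧ y = some (l', e) ∧ blk l t = blk l' t' then 1 else 0 := by
    rintro (_ | ⟨l, e⟩) (_ | ⟨l', e'⟩)
    · simp [GadgetCode.cross]
    · simp [GadgetCode.cross]
    · simp [GadgetCode.cross]
    · by_cases he : e = e'
      · simp [GadgetCode.cross, he]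
      · simp [GadgetCode.cross, he, Ne.symm he]
  exact (key (γ.reader j) (γ.writer j')).trans (if_congr Iff.rfl rfl rfl)

open Classical in
theorem bit_code (t t' : Fin L) (j j' : Fin γ.g) :
    (γ.code num).bit blk t j t' j' =
      if (copies γ.graph (γ.Reads blk) L).Adj (t, j) (t', j') then 1 else 0 := by
  rw [GadgetCode.bit, cross_link, cross_link]
  rcases lt_trichotomy t t' with h | h | h
  · simp [copies, h, h.not_gt, h.ne]
  · subst h; simp [copies, code]
  · simp [copies, h, h.not_gt, h.ne']

theorem pin_code (t : ℕ) (j : Fin γ.g) :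
    (γ.code num).pin ty t j =
      (γ.pinned (fun l => ty l t) j).elim 0 fun v => (num v : ℕ) + 1 := by
  simp only [GadgetCode.pin, code, pinned]
  rcases γ.cond j with _ | c
  · simp
  · simp only [Option.elim_some]
    split_ifs <;> simp

theorem _root_.List.flatMap_finRange_mul {α : Type} (m n : ℕ) (f : Fin (m * n) → List α) :
    (List.finRange (m * n)).flatMap f = (List.finRange m).flatMap fun i =>
      (List.finRange n).flatMap fun j => f (finProdFinEquiv (i, j)) := by
  have h : List.finRange (m * n) = (List.finRange m).flatMap fun i =>
      (List.finRange n).map fun j => finProdFinEquiv (i, j) := by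
    rw [← List.ofFn_id, List.ofFn_mul, List.flatMap, ← List.ofFn_eq_map]
    congr 2
    funext i
    rw [← List.ofFn_eq_map]
    congr 1
    funext j
    ext
    simp [mul_comm, add_comm]
  rw [h, List.flatMap_assoc]
  simp [List.flatMap_map]

theorem _root_.List.flatMap_range_eq {α : Type} (m : ℕ) (f : ℕ → List α) :
    (List.range m).flatMap f = (List.finRange m).flatMap fun i : Fin m => f i := by
  rw [← List.map_coe_finRange_eq_range, List.flatMap_map]

/-- `finProdFinEquiv` numbers the vertices copy by copy, the order in which the nested loops of the
program write them. -/
theorem encode_inst : (γ.inst blk ty L).encode num = (γ.code num).output blk ty L := by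
  classical
  rw [ExtInstance.encode, GadgetCode.output, GadgetCode.matrix, GadgetCode.pins]
  simp only [List.flatMap_range_eq]
  congr 2
  · refine (List.flatMap_finRange_mul L γ.g _).trans ?_
    refine congrArg (List.flatMap · _) (funext fun t => congrArg (List.flatMap · _)
      (funext fun j => ?_))
    rw [List.map_eq_flatMap]
    refine (List.flatMap_finRange_mul L γ.g _).trans ?_
    refine congrArg (List.flatMap · _) (funext fun t' => congrArg (List.flatMap · _)
      (funext fun j' => ?_))
    rw [bit_code]
    simp [inst]
  · rw [List.map_eq_flatMap]
    refine (List.flatMap_finRange_mul L γ.g _).trans ?_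
    refine congrArg (List.flatMap · _) (funext fun t => congrArg (List.flatMap · _)
      (funext fun j => ?_))
    rw [pin_code]
    simp [inst]

theorem hasExtension_inst {H : LoopGraph V} : (γ.inst blk ty L).HasExtension H ↔
    ∃ f : Fin L × Fin γ.g → V,
      (∀ u v, (copies γ.graph (γ.Reads blk) L).Adj u v → H.Adj (f u) (f v)) ∧
      ∀ u, ∀ v ∈ γ.pinned (fun l => ty l u.1) u.2, f u = v := by
  constructor
  · rintro ⟨f, hf⟩
    refine ⟨fun u => f (finProdFinEquiv u), fun u v huv => f.map_rel ?_, fun u v hv =>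
      hf _ v ?_⟩
    · simpa [inst] using huv
    · simpa [inst] using hv
  · rintro ⟨f, hf, hpin⟩
    exact ⟨⟨fun u => f (finProdFinEquiv.symm u), fun h => hf _ _ h⟩, fun u v huv => hpin _ _ huv⟩

/-- To a reader, an earlier writer is determined by its block and its index e. These `nb * p` pairs
are labels; one more serves the vertices that write nothing, and `γ.g` more the newest copy. -/
theorem cliqueWidth_inst_le {nb : ℕ} (hnb : ∀ l < k, ∀ x < L, blk l x < nb) :
    cliqueWidth (γ.inst blk ty L).G ≤ nb * p + 1 + γ.g := by
  classical
  rcases Nat.eq_zero_or_pos L with rfl | hL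
  · have : IsEmpty (Fin (γ.inst blk ty 0).n) := by
      have : (γ.inst blk ty 0).n = 0 := by simp [inst]
      rw [this]; infer_instance
    rw [cliqueWidth_eq_zero_of_isEmpty]; exact Nat.zero_le _
  -- Labels are required for all copy numbers, while `hnb` bounds only those below `L`. Extending by
  -- zero needs `0 < nb`, which is why `L = 0` was treated separately.
  let blk' : ℕ → ℕ → ℕ := fun l x => if x < L then blk l x else 0
  have hnb' : ∀ (l : Fin k) x, blk' l x < nb := fun l x => by
    simp only [blk']
    split_ifs with h
    exacts [hnb l l.2 x h, (Nat.zero_le _).trans_lt (hnb l l.2 0 hL)]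
  have hcopies : copies γ.graph (γ.Reads blk) L = copies γ.graph (γ.Reads blk') L := by
    ext u v
    simp [copies, Reads, blk']
  let lab : ℕ → Fin γ.g → Fin (nb * p + 1) := fun t j => (γ.writer j).elim (Fin.last _) fun x =>
    (finProdFinEquiv (⟨blk' x.1 t, hnb' _ _⟩, x.2)).castSucc
  change cliqueWidth ((copies γ.graph (γ.Reads blk) L).comap finProdFinEquiv.symm) ≤ _
  rw [← cliqueWidth_congr (SimpleGraph.Iso.comap finProdFinEquiv.symm _).symm, hcopies]
  refine cliqueWidth_copies_le γ.graph _ lab (fun t j i => ∃ l e, γ.reader j = some (l, e) ∧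
    i = (finProdFinEquiv (⟨blk' l t, hnb' _ _⟩, e)).castSucc) (fun t j t' j' => ?_) L
  simp only [Reads, lab]
  constructor
  · rintro ⟨l, l', e, h, h', hb⟩
    exact ⟨l, e, h, by simp [h', hb]⟩
  · rintro ⟨l, e, h, h'⟩
    rcases hw : γ.writer j' with _ | ⟨l', e'⟩
    · rw [hw] at h'
      exact absurd h' (Fin.castSucc_lt_last _).ne'
    · rw [hw] at h'
      simp only [Option.elim_some, Fin.castSucc_inj, EmbeddingLike.apply_eq_iff_eq, Prod.mk.injEq,
        Fin.mk.injEq] at h'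
      exact ⟨l, l', e, h, by rw [h'.2], h'.1.symm⟩

end Gadget

/-! ### Formulas -/

namespace KCnf

variable {k : ℕ} (φ : KCnf k)

/-- The code of the literal in slot `l` of clause `c`. -/
def literal (c l : ℕ) : ℕ := φ.encode.getD (2 + c * k + l) 0

theorem _root_.List.getD_flatMap_ofFn {α : Type} (f : α → Fin k → ℕ) (cs : List α) {c : ℕ}
    (hc : c < cs.length) (l : Fin k) :
    (cs.flatMap fun x => List.ofFn (f x)).getD (c * k + l) 0 = f cs[c] l := by
  induction cs generalizing c with
  | nil => simp at hc
  | cons x cs ih =>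
    rcases c with _ | c
    · rw [List.flatMap_cons, List.getD_append _ _ _ _ (by simp)]
      simp
    · rw [List.flatMap_cons, List.getD_append_right _ _ _ _ (by simp [add_mul]; lia)]
      have : (c + 1) * k + l - (List.ofFn (f x)).length = c * k + l := by
        simp [add_mul]; lia
      rw [this, ih (by simpa using hc)]
      simp

theorem literal_eq {c : ℕ} (hc : c < φ.clauses.length) (l : Fin k) :
    φ.literal c l = 2 * ((φ.clauses[c] l).1 : ℕ) + (φ.clauses[c] l).2.toNat := by
  rw [literal, encode]
  have : 2 + c * k + (l : ℕ) = c * k + l + 1 + 1 := by ring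
  rw [this, List.getD_cons_succ, List.getD_cons_succ]
  exact List.getD_flatMap_ofFn (fun (x : Fin k → Fin φ.n × Bool) j =>
    2 * ((x j).1 : ℕ) + (x j).2.toNat) φ.clauses hc l

theorem literal_lt {c l : ℕ} (hc : c < φ.clauses.length) (hl : l < k) :
    φ.literal c l < 2 * φ.n := by
  have := φ.literal_eq hc ⟨l, hl⟩
  have h₁ := (φ.clauses[c] ⟨l, hl⟩).1.2
  have h₂ := (φ.clauses[c] ⟨l, hl⟩).2.toNat_le
  simp only at this
  lia

/-- The assignment `a` of a block of `τ` variables satisfies the literal of type `θ`. -/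
def BlockSat (τ : ℕ) (a : Fin τ → Bool) (θ : ℕ) : Prop :=
  ∃ h : θ / 2 < τ, (a ⟨θ / 2, h⟩).toNat = θ % 2

/-- For a variable v = Bτ + i, division of the code 2v + b by 2τ has the block B as quotient and the
type 2i + b as remainder. -/
theorem satisfiable_iff {τ : ℕ} (hτ : 0 < τ) : φ.Satisfiable ↔
    ∃ a : ℕ → Fin τ → Bool, ∀ c < φ.clauses.length, ∃ l : Fin k,
      BlockSat τ (a (φ.literal c l / (2 * τ))) (φ.literal c l % (2 * τ)) := by
  have h₁ : ∀ (v : ℕ) (b : Bool), (2 * v + b.toNat) / (2 * τ) = v / τ := fun v b => by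
    rw [← Nat.div_div_eq_div_mul]; congr 1
    have := b.toNat_le; lia
  have h₂ : ∀ (v : ℕ) (b : Bool), (2 * v + b.toNat) % (2 * τ) / 2 = v % τ := fun v b => by
    rw [Nat.mod_mul_right_div_self]; congr 1
    have := b.toNat_le; lia
  have h₃ : ∀ (v : ℕ) (b : Bool), (2 * v + b.toNat) % (2 * τ) % 2 = b.toNat := fun v b => by
    rw [Nat.mod_mul_right_mod]
    have := b.toNat_le; lia
  have hinj : ∀ b c : Bool, b.toNat = c.toNat ↔ b = c := by decide
  have key : ∀ (a : ℕ → Fin τ → Bool) (v : ℕ) (b : Bool),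
      BlockSat τ (a ((2 * v + b.toNat) / (2 * τ))) ((2 * v + b.toNat) % (2 * τ)) ↔
        a (v / τ) ⟨v % τ, Nat.mod_lt _ hτ⟩ = b := by
    intro a v b
    simp only [BlockSat, h₁, h₂, h₃, hinj]
    exact ⟨fun ⟨_, h⟩ => h, fun h => ⟨Nat.mod_lt _ hτ, h⟩⟩
  constructor
  · rintro ⟨α, hα⟩
    let a : ℕ → Fin τ → Bool := fun B i => if h : B * τ + i < φ.n then α ⟨B * τ + i, h⟩ else false
    refine ⟨a, fun c hc => ?_⟩
    obtain ⟨l, hl⟩ := hα _ (List.getElem_mem hc)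
    refine ⟨l, ?_⟩
    rw [φ.literal_eq hc, key]
    have e : ((φ.clauses[c] l).1 : ℕ) / τ * τ + ((φ.clauses[c] l).1 : ℕ) % τ =
      (φ.clauses[c] l).1 := Nat.div_add_mod' _ _
    simp only [a, e]
    rw [dif_pos (φ.clauses[c] l).1.2, ← hl]
  · rintro ⟨a, ha⟩
    refine ⟨fun v => a (v / τ) ⟨v % τ, Nat.mod_lt _ hτ⟩, fun x hx => ?_⟩
    obtain ⟨c, hc, rfl⟩ := List.getElem_of_mem hx
    obtain ⟨l, hl⟩ := ha c hc
    rw [φ.literal_eq hc, key] at hl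
    exact ⟨l, hl⟩

theorem length_encode : φ.encode.length = φ.clauses.length * k + 2 := by
  simp [encode, List.length_flatMap]

theorem getD_encode_le (x : ℕ) : φ.encode.getD x 0 ≤ 2 * φ.n + φ.clauses.length := by
  rw [List.getD_eq_getElem?_getD]
  rcases h : φ.encode[x]? with _ | y
  · simp
  have hy := List.mem_of_getElem? h
  simp only [encode, List.mem_cons, List.mem_flatMap, List.mem_ofFn] at hy
  simp only [Option.getD_some]
  rcases hy with rfl | rfl | ⟨c, -, j, rfl⟩
  · lia
  · lia
  · have := (c j).1.2
    have := (c j).2.toNat_le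
    lia

end KCnf

/-! ### Trivial graphs -/

namespace LoopGraph

variable {V : Type} {H : LoopGraph V}

theorem isCore_of_subsingleton [Subsingleton V] : H.IsCore :=
  fun _ => ⟨RelIso.refl _, fun _ => Subsingleton.elim _ _⟩

theorem isTrivial_of_hom {v : V} (h : Nonempty (Hom H (H.induce {v}))) : H.IsTrivial :=
  ⟨{v}, ⟨isCore_of_subsingleton, h⟩, Set.finite_singleton v, by simp⟩

theorem not_adj_self_of_not_isTrivial (hH : ¬ H.IsTrivial) (v : V) : ¬ H.Adj v v := fun hv =>
  hH (isTrivial_of_hom (v := v) ⟨⟨fun _ => ⟨v, rfl⟩, fun _ => hv⟩⟩)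

theorem exists_adj_of_not_isTrivial (hH : ¬ H.IsTrivial) : ∃ u v, H.Adj u v := by
  by_contra! h
  refine hH ?_
  rcases isEmpty_or_nonempty V with hV | ⟨⟨v⟩⟩
  · exact ⟨∅, ⟨isCore_of_subsingleton, ⟨⟨fun v => isEmptyElim v, fun {a} => isEmptyElim a⟩⟩⟩,
      Set.finite_empty, by simp⟩
  · exact isTrivial_of_hom (v := v) ⟨⟨fun _ => ⟨v, rfl⟩, fun {a b} hab => absurd hab (h a b)⟩⟩

/-- The neighbourhoods of the ends of an edge differ, as there are no loops. This keeps the base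
`max (s - ε) 1` below `s`. -/
theorem one_lt_signatureNumber [Finite V] (hloop : ∀ v, ¬ H.Adj v v) {a b : V} (hab : H.Adj a b) :
    1 < H.signatureNumber := by
  refine (Set.one_lt_ncard_iff (Set.toFinite _)).2 ⟨H.commonNbrs {a}, H.commonNbrs {b},
    ⟨⟨b, by simpa [commonNbrs] using hab⟩, {a}, Set.singleton_nonempty a, rfl⟩,
    ⟨⟨a, by simpa [commonNbrs] using H.symm _ _ hab⟩, {b}, Set.singleton_nonempty b, rfl⟩, ?_⟩
  intro e
  have : b ∈ H.commonNbrs {a} := by simpa [commonNbrs] using hab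
  rw [e] at this
  exact hloop b (by simpa [commonNbrs] using this)

/-- Split off one factor of a product. -/
def piIsoProd {m : ℕ} {U : Fin m → Type} (F : ∀ j, LoopGraph (U j)) (i : Fin m) :
    Iso (pi F) ((F i).prod (pi fun j : {j : Fin m // j ≠ i} => F j)) where
  toEquiv := Equiv.piSplitAt i U
  map_rel_iff' := by
    intro x y
    refine ⟨fun h j => ?_, fun h => ⟨h i, fun j => h j⟩⟩
    by_cases hj : j = i
    · subst hj; exact h.1
    · exact h.2 ⟨j, hj⟩

end LoopGraph

/-! ### Running times -/

theorem RamProg.Run.pos {p : RamProg} {σ σ' : RamState} {t : ℕ} (h : p.Run σ t σ') : 0 < t := by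
  induction h <;> lia

/-- A number cannot gain more bits than the time spent, which bounds the cost of copying the answer
of the solver. -/
theorem RamProg.Run.bdd {p : RamProg} {σ σ' : RamState} {t : ℕ} (h : p.Run σ t σ') :
    ∀ b, σ.Bdd b → σ'.Bdd (b + t) := by
  induction h with
  | skip σ => exact fun b hb => hb.mono (by lia)
  | const σ r c => exact fun b hb => (hb.mono (by lia)).setReg (by lia)
  | add σ r s t =>
    exact fun b hb => (hb.mono (by lia)).setReg
      ((Nat.size_add_le (hb.1 s) (hb.1 t)).trans (by lia))
  | sub σ r s t =>
    exact fun b hb => (hb.mono (by lia)).setReg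
      ((Nat.size_le_size (Nat.sub_le _ _)).trans ((hb.1 s).trans (by lia)))
  | load σ r a s => exact fun b hb => (hb.mono (by lia)).setReg ((hb.2 _ _).trans (by lia))
  | store σ a r s => exact fun b hb => (hb.mono (by lia)).setMem ((hb.1 _).trans (by lia))
  | seq p q σ σ₁ σ₂ t₁ t₂ h₁ h₂ ih₁ ih₂ =>
    exact fun b hb => (ih₂ _ (ih₁ b hb)).mono (by lia)
  | ite_true r p q σ σ₁ t h h₁ ih => exact fun b hb => (ih b hb).mono (by lia)
  | ite_false r p q σ σ₁ t h h₁ ih => exact fun b hb => (ih b hb).mono (by lia)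
  | loop_done r p σ h => exact fun b hb => hb.mono (by lia)
  | loop_step r p σ σ₁ σ₂ t₁ t₂ h h₁ h₂ ih₁ ih₂ =>
    exact fun b hb => (ih₂ _ (ih₁ b hb)).mono (by lia)

theorem KCnf.bdd_init {k : ℕ} (φ : KCnf k) :
    (RamState.init φ.encode).Bdd (2 * φ.n + φ.clauses.length * (k + 1) + 2) := by
  have hs : ∀ x : ℕ, x.size ≤ x := fun x => by rw [Nat.size_le]; exact Nat.lt_two_pow_self
  refine ⟨fun r => (hs _).trans ?_, fun a x => (hs _).trans ?_⟩
  · simp only [RamState.init, φ.length_encode]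
    split_ifs
    · lia
    · lia
  · have := φ.getD_encode_le x
    simp only [RamState.init]
    split_ifs
    · lia
    · lia

theorem Polynomial.eval_mono_nat (p : Polynomial ℕ) {x y : ℕ} (h : x ≤ y) :
    p.eval x ≤ p.eval y := by
  rw [Polynomial.eval_eq_sum, Polynomial.eval_eq_sum]
  exact Finset.sum_le_sum fun i _ => Nat.mul_le_mul_left _ (Nat.pow_le_pow_left h i)

/-- Numbers of variables over an alphabet of size `s` that represent blocks of bits, such that
exhaustive search with base `β < s` beats exhaustive search over the bits. -/
theorem exists_block_size {s : ℕ} {β : ℝ} (h₁ : 1 ≤ β) (h₂ : β < s) :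
    ∃ p τ : ℕ, 0 < τ ∧ 2 ^ τ ≤ s ^ p ∧ β ^ p < 2 ^ τ := by
  have hβ : 0 < β := by linarith
  -- With (s/β)^p > 2, rounding log₂(s^p) down to τ is affordable: it costs a factor less than 2.
  obtain ⟨p, hp⟩ := pow_unbounded_of_one_lt (2 : ℝ) ((one_lt_div hβ).2 h₂)
  rw [div_pow, lt_div_iff₀ (pow_pos hβ p)] at hp
  have hs : s ≠ 0 := by
    rintro rfl
    simp at h₂
    linarith
  have hle : 2 ^ Nat.log 2 (s ^ p) ≤ s ^ p := Nat.pow_log_le_self 2 (pow_ne_zero p hs)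
  have hlt : s ^ p < 2 ^ (Nat.log 2 (s ^ p) + 1) := Nat.lt_pow_succ_log_self (by lia) _
  have hlt' : (s : ℝ) ^ p < 2 ^ (Nat.log 2 (s ^ p) + 1) := by exact_mod_cast hlt
  have hβp : β ^ p < 2 ^ Nat.log 2 (s ^ p) := by
    rw [pow_succ] at hlt'
    linarith
  refine ⟨p, Nat.log 2 (s ^ p), Nat.pos_of_ne_zero fun h0 => ?_, hle, hβp⟩
  rw [h0, pow_zero] at hβp
  exact absurd (one_le_pow₀ h₁) hβp.not_ge

theorem cliqueWidth_bot_one : cliqueWidth (⊥ : SimpleGraph (Fin 1)) = 1 := by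
  have h : HasExpr 1 (⊥ : SimpleGraph (Fin 1)) fun _ => 0 := HasExpr.discrete 0 _
  have hle := h.cliqueWidth_le
  refine le_antisymm hle (Nat.one_le_iff_ne_zero.2 fun h0 => ?_)
  obtain ⟨U, K, m, hK, f, -⟩ := h
  have := Nat.sInf_mem (s := {k | ∃ (W : Type) (G' : SimpleGraph W) (l : W → Fin k),
    KGraph k G' l ∧ Nonempty (G' ≃g (⊥ : SimpleGraph (Fin 1)))}) ⟨1, U, K, m, hK, ⟨f⟩⟩
  change cliqueWidth (⊥ : SimpleGraph (Fin 1)) ∈ _ at this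
  rw [h0] at this
  obtain ⟨W, G', l, hG, -⟩ := this
  obtain ⟨w⟩ := hG.nonempty
  exact (l w).elim0

/-- A fast algorithm for the extension problem gives one for `k`-SAT. -/
theorem LoopGraph.ProjectiveWith.solvableInTime_kSat {V A B : Type} {N : ℕ} [Finite A] [Finite B]
    {P : LoopGraph A} {W : LoopGraph B} (h : P.ProjectiveWith W) {H : LoopGraph V}
    (num : V ≃ Fin N) (ψ : Iso H (P.prod W)) (hloop : ∀ x, ¬ P.Adj x x) {u v : V} (huv : H.Adj u v)
    {T : ℕ → ℝ} {β δ : ℝ} (hβ : 1 ≤ β) (hT : ∀ n, T n ≤ β ^ n) {p τ : ℕ} (hτ : 0 < τ)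
    (hs : 2 ^ τ ≤ P.signatureNumber ^ p) (hδ : 0 ≤ δ) (hβδ : β ^ p = 2 ^ (δ * τ))
    (hsol : (hColoringExtension H num).SolvableInTime T) (k : ℕ) :
    (kSat k).SolvableInTime fun n => (2 : ℝ) ^ (δ * n) := by
  classical
  have := Fintype.ofFinite A
  have huv' := ψ.map_rel_iff.2 huv
  have hβ0 : 0 < β := by linarith
  have hfin : Finite P.signatureSets := (Set.toFinite _).to_subtype
  have := Fintype.ofFinite P.signatureSets
  obtain ⟨enc⟩ : Nonempty ((Fin τ → Bool) ↪ (Fin p → P.signatureSets)) := by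
    refine Function.Embedding.nonempty_of_card_le ?_
    rw [Fintype.card_fun, Fintype.card_fun, ← Nat.card_eq_fintype_card (α := P.signatureSets)]
    simpa [LoopGraph.signatureNumber] using hs
  obtain ⟨γ, hγ⟩ := h.exists_gadget (k := k) (D := 2 * τ) ψ hloop huv'.1 huv'.2
    (KCnf.BlockSat τ) (fun c e => (enc c e : Set A)) (fun c e => (enc c e).2)
  obtain ⟨M, hM⟩ := (γ.code num).exists_bdd
  obtain ⟨prog, pol, hprog⟩ := hsol
  -- This constant absorbs the labels beyond p⌊n/τ⌋: those of one further block, of the vertices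
  -- that write nothing, and of one gadget. It is independent of the formula.
  obtain ⟨K₀, hK₀⟩ := exists_nat_ge (β ^ (p + 1 + γ.g))
  have h2τ : 0 < 2 * τ := by lia
  -- The left side is the number of triples that can be lost as sets shrink; the right side is the
  -- number of rounds.
  have hround : ∀ n, (n / τ + 1) * (p * Fintype.card A) < (n + 1) * (p * Fintype.card A + 1) :=
    fun n => (Nat.mul_le_mul_right _ (Nat.succ_le_succ (Nat.div_le_self n τ))).trans_lt
      (Nat.mul_lt_mul_of_pos_left (Nat.lt_succ_self _) (Nat.succ_pos n))
  set r₀ := p * Fintype.card A + 1 with hr₀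
  let LP : Polynomial ℕ := (Polynomial.X + 1) * (r₀ : Polynomial ℕ) * Polynomial.X
  let NP : Polynomial ℕ := (Polynomial.X + 1) * 3 + ((2 * τ : ℕ) : Polynomial ℕ) + (γ.g : Polynomial ℕ) +
      (r₀ : Polynomial ℕ) + 14 + ((Polynomial.X + 1) * (r₀ : Polynomial ℕ) * (Polynomial.X *
        ((k : Polynomial ℕ) * (2 * Polynomial.X * 5 + 9 + (k : Polynomial ℕ)) + (k : Polynomial ℕ) + 7) + 9) + 5) +
      ((LP * ((γ.g : Polynomial ℕ) * (LP * ((γ.g : Polynomial ℕ) * ((M : Polynomial ℕ) + 13) + 1 + 3) + 3)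
        + 1 + 3) + 3) + (LP * ((γ.g : Polynomial ℕ) * (2 * (M : Polynomial ℕ) + 9) + 1 + 3) + 3))
  let BP : Polynomial ℕ := 2 * Polynomial.X + Polynomial.X * ((k : Polynomial ℕ) + 1) + 2
  -- After the renamed solver, its answer is moved from register 16 to register 0.
  refine ⟨.seq ((γ.code num).reduction (2 * τ) r₀) (.seq (prog.shift 16 (2 * k + 1))
    (.seq (.const 0 0) (.add 0 16 0))), 2 * (NP * (1 + 2 * (BP + NP))) +
      2 * ((K₀ : Polynomial ℕ) * pol.comp (LP * (γ.g : Polynomial ℕ))) + BP + 2,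
      fun (φ : KCnf k) => ?_⟩
  set C := φ.clauses.length with hC
  set L := (φ.n + 1) * r₀ * C with hL
  set blk : ℕ → ℕ → ℕ := fun l x => φ.literal (x % C) l / (2 * τ) with hblk
  set ty : ℕ → ℕ → ℕ := fun l x => φ.literal (x % C) l % (2 * τ) with hty
  have hlit : ∀ c < C, ∀ l < k, φ.literal c l < 2 * φ.n := fun c hc l hl => φ.literal_lt hc hl
  have hnb : ∀ l < k, ∀ x < C, blk l x < φ.n / τ + 1 := fun l hl x hx => by
    have := hlit _ (Nat.mod_lt x (by lia)) l hl
    rw [Nat.lt_succ_iff]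
    simp only [hblk]
    calc _ ≤ 2 * φ.n / (2 * τ) := Nat.div_le_div_right this.le
      _ = φ.n / τ := Nat.mul_div_mul_left _ _ (by lia)
  have hnb' : ∀ l < k, ∀ x < L, blk l x < φ.n / τ + 1 := fun l hl x hx => by
    have hC0 : 0 < C := Nat.pos_of_ne_zero fun h0 => by simp [hL, h0] at hx
    have := hnb l hl (x % C) (Nat.mod_lt _ hC0)
    simpa [hblk] using this
  obtain ⟨t₂, σ₂, hrun, ht₂, hyes⟩ := hprog (γ.inst blk ty L)
  have hred := (γ.code num).wp_reduction (M := M) (L := L) (C := C) (n := φ.n) (r₀ := r₀)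
    (D := 2 * τ) (B := 2 * φ.n) (lit := φ.literal) (I := φ.encode) rfl rfl
    (fun c _ l _ => rfl) (by lia) (fun c hc l hl => (hlit c hc l hl).le) hM rfl
  have hinit := φ.bdd_init
  rw [← hC] at hinit
  obtain ⟨t₁, ρ₁, hrun₁, hcont, hbdd₁, ht₁⟩ := hred _ hinit
  rw [← hblk, ← hty, ← γ.encode_inst num] at hcont
  obtain ⟨ρ₂, hrun₂, hcont₂⟩ := hrun.shift ρ₁ hcont
  have hbdd₂ := hrun₂.bdd _ hbdd₁
  refine ⟨_, _, .seq _ _ _ _ _ _ _ hrun₁ (.seq _ _ _ _ _ _ _ hrun₂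
    (.seq _ _ _ _ _ _ _ (.const _ _ _) (.add _ _ _ _))), ?_, ?_⟩
  · have hcw : (hColoringExtension H num).param (γ.inst blk ty L) ≤ (φ.n / τ + 1) * p + 1 + γ.g :=
      γ.cliqueWidth_inst_le hnb'
    have hsize : (hColoringExtension H num).size (γ.inst blk ty L) = L * γ.g := rfl
    have hn : φ.n ≤ φ.n + C := Nat.le_add_right _ _
    have hC' : C ≤ φ.n + C := Nat.le_add_left _ _
    change _ ≤ (2 : ℝ) ^ (δ * φ.n) * ((Polynomial.eval (φ.n + C) _ : ℕ) : ℝ)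
    generalize φ.n + C = z at hn hC' ⊢
    have hLP : L ≤ LP.eval z := by
      simp only [LP, Polynomial.eval_mul, Polynomial.eval_add, Polynomial.eval_X,
        Polynomial.eval_one, Polynomial.eval_natCast, Nat.cast_id, hL]
      gcongr
    have hBP : 2 * φ.n + C * (k + 1) + 2 ≤ BP.eval z := by
      simp only [BP, Polynomial.eval_mul, Polynomial.eval_add, Polynomial.eval_X,
        Polynomial.eval_one, Polynomial.eval_natCast, Polynomial.eval_ofNat, Nat.cast_id]
      gcongr
    have hNP : (φ.n + 1) * 3 + 2 * τ + γ.g + r₀ + 14 +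
        ((φ.n + 1) * r₀ * (C * (k * (2 * φ.n * 5 + 9 + k) + k + 7) + 9) + 5) +
        ((L * (γ.g * (L * (γ.g * (M + 13) + 1 + 3) + 3) + 1 + 3) + 3) +
          (L * (γ.g * (2 * M + 9) + 1 + 3) + 3)) ≤ NP.eval z := by
      simp only [NP, Polynomial.eval_mul, Polynomial.eval_add, Polynomial.eval_X,
        Polynomial.eval_one, Polynomial.eval_natCast, Polynomial.eval_ofNat, Nat.cast_id]
      gcongr
    clear_value NP BP LP
    generalize (φ.n + 1) * 3 + 2 * τ + γ.g + r₀ + 14 +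
        ((φ.n + 1) * r₀ * (C * (k * (2 * φ.n * 5 + 9 + k) + k + 7) + 9) + 5) +
        ((L * (γ.g * (L * (γ.g * (M + 13) + 1 + 3) + 3) + 1 + 3) + 3) +
          (L * (γ.g * (2 * M + 9) + 1 + 3) + 3)) = n₁ at *
    generalize 2 * φ.n + C * (k + 1) + 2 = b at *
    rw [hsize] at ht₂
    have ht₂' : (t₂ : ℝ) ≤ (2 : ℝ) ^ (δ * φ.n) * (K₀ * pol.eval (LP.eval z * γ.g) : ℕ) := by
      refine ht₂.trans ?_
      have e₁ : ((pol.eval (L * γ.g) : ℕ) : ℝ) ≤ (pol.eval (LP.eval z * γ.g) : ℕ) := by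
        exact_mod_cast pol.eval_mono_nat (Nat.mul_le_mul_right _ hLP)
      have e₂ : T ((hColoringExtension H num).param (γ.inst blk ty L)) ≤
          2 ^ (δ * φ.n) * (K₀ : ℝ) := by
        refine (hT _).trans ((pow_le_pow_right₀ hβ hcw).trans ?_)
        rw [show (φ.n / τ + 1) * p + 1 + γ.g = p * (φ.n / τ) + (p + 1 + γ.g) by ring, pow_add]
        refine mul_le_mul ?_ hK₀ (by positivity) (by positivity)
        -- The main factor is β^(p⌊n/τ⌋) = 2^(δτ⌊n/τ⌋) ≤ 2^(δn).
        rw [pow_mul, hβδ, ← Real.rpow_natCast, ← Real.rpow_mul (by norm_num)]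
        refine Real.rpow_le_rpow_of_exponent_le (by norm_num) ?_
        rw [mul_assoc]
        refine mul_le_mul_of_nonneg_left ?_ hδ
        exact_mod_cast Nat.mul_div_le φ.n τ
      rw [Nat.cast_mul, ← mul_assoc]
      exact mul_le_mul e₂ e₁ (Nat.cast_nonneg _) (by positivity)
    have hY : (1 : ℝ) ≤ 2 ^ (δ * φ.n) :=
      Real.one_le_rpow (by norm_num) (mul_nonneg hδ (Nat.cast_nonneg _))
    have hE₁ : t₁ ≤ NP.eval z * (1 + 2 * (BP.eval z + NP.eval z)) := ht₁.trans (by gcongr)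
    have hE₂ : (ρ₂.reg 16).size ≤ BP.eval z + NP.eval z + t₂ := (hbdd₂.1 16).trans (by gcongr)
    simp only [Polynomial.eval_mul, Polynomial.eval_add, Polynomial.eval_one,
      Polynomial.eval_natCast, Polynomial.eval_ofNat, Nat.cast_id, Polynomial.eval_comp, RamState.reg_setReg,
      if_true, if_neg (show (16 : ℕ) ≠ 0 by norm_num), Nat.size_zero]
    generalize (2 : ℝ) ^ (δ * φ.n) = Y at *
    generalize K₀ * pol.eval (LP.eval z * γ.g) = X at *
    generalize NP.eval z = E at *
    generalize BP.eval z = b' at *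
    have hnat : t₁ + (t₂ + (1 + 0 + (1 + (ρ₂.reg 16).size + 0))) ≤
        (2 * (E * (1 + 2 * (b' + E))) + b' + 2) + 2 * t₂ := by nlinarith
    have hcast : ((t₁ + (t₂ + (1 + 0 + (1 + (ρ₂.reg 16).size + 0))) : ℕ) : ℝ) ≤
        ((2 * (E * (1 + 2 * (b' + E))) + b' + 2 : ℕ) : ℝ) + 2 * t₂ := by exact_mod_cast hnat
    refine hcast.trans ?_
    have hle : ((2 * (E * (1 + 2 * (b' + E))) + b' + 2 : ℕ) : ℝ) ≤
        Y * ((2 * (E * (1 + 2 * (b' + E))) + b' + 2 : ℕ) : ℝ) :=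
      le_mul_of_one_le_left (Nat.cast_nonneg _) hY
    push_cast at *
    linarith
  · have e₀ : ρ₂.reg 16 = σ₂.reg 0 := hcont₂.1 0
    simp only [RamState.reg_setReg, if_true, if_neg (show (16 : ℕ) ≠ 0 by norm_num), add_zero, e₀]
    refine hyes.trans ?_
    refine γ.hasExtension_inst.trans ?_
    refine (hγ.exists_hom_iff (fun u v huv => (ψ.map_rel_iff.2 huv).1) (fun c c' hcc =>
      enc.injective (funext fun e => Subtype.ext (congrFun hcc e))) (nb := φ.n / τ + 1) (blk := blk) (ty := ty)
      (fun l x => by simp only [hblk, Nat.mod_mod]) (fun l x => by simp only [hty, Nat.mod_mod]) hnb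
      (fun l hl x hx => Nat.mod_lt _ h2τ) ?_).trans ?_
    · exact hround _
    · refine Iff.trans ?_ (φ.satisfiable_iff hτ).symm
      refine exists_congr fun a => forall₂_congr fun c hc => ?_
      simp only [hblk, hty, Nat.mod_eq_of_lt hc]

theorem mainTheorem3 {V : Type} {N : ℕ} (num : V ≃ Fin N) (H : LoopGraph V)
    (hcore : H.IsCore) (hH : ¬ H.IsTrivial)
    {m : ℕ} {U : Fin m → Type} (F : ∀ j, LoopGraph (U j))
    (hF : H.IsPrimeFactorization F) (i : Fin m) (hproj : LoopGraph.IsProjectiveAt F i)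
    (hSETH : SETH) (ε : ℝ) (hε : 0 < ε) :
    ¬ (hColoringExtension H num).SolvableInTime
        fun cw => (((F i).signatureNumber : ℝ) - ε) ^ cw := by
  intro hsol
  obtain ⟨⟨φ⟩, -⟩ := hF
  let ψ := φ.trans (LoopGraph.piIsoProd F i)
  obtain ⟨u, v, huv⟩ := LoopGraph.exists_adj_of_not_isTrivial hH
  have huv' := ψ.map_rel_iff.2 huv
  have hloop := LoopGraph.not_adj_self_of_not_isTrivial hproj.1
  have : Finite V := Finite.of_equiv _ num.symm
  -- The factors are images of the finite vertex set of `H`; the vertex `u` supplies the missing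
  -- coordinates.
  have : Finite (U i) := Finite.of_surjective (fun v => (ψ v).1) fun x =>
    ⟨ψ.symm (x, (ψ u).2), by simp⟩
  have : Finite (∀ j : {j : Fin m // j ≠ i}, U j) := Finite.of_surjective (fun v => (ψ v).2)
    fun x => ⟨ψ.symm ((ψ u).1, x), by simp⟩
  have hs : 1 < (F i).signatureNumber := LoopGraph.one_lt_signatureNumber hloop huv'.1
  set s := (F i).signatureNumber
  -- The one-vertex graph has clique-width 1, so a base that is not positive would leave no time for
  -- its run, which takes at least one step.
  have hpos : 0 < (s : ℝ) - ε := by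
    obtain ⟨prog, pol, h⟩ := hsol
    obtain ⟨t, σ, hrun, ht, -⟩ := h ⟨1, ⊥, fun _ => none⟩
    have h1 : (hColoringExtension H num).param ⟨1, ⊥, fun _ => none⟩ = 1 := cliqueWidth_bot_one
    beta_reduce at ht
    rw [h1, pow_one] at ht
    have ht' : (0 : ℝ) < t := by exact_mod_cast hrun.pos
    by_contra! hneg
    exact absurd (ht.trans (mul_nonpos_of_nonpos_of_nonneg hneg (Nat.cast_nonneg _))) ht'.not_ge
  -- The base is raised to at least 1 so that its powers are monotone in the clique-width, for which
  -- only an upper bound is known.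
  obtain ⟨p, τ, hτ, hle, hlt⟩ := exists_block_size (s := s) (β := max (s - ε) 1)
    (le_max_right _ _) (max_lt (by linarith) (by exact_mod_cast hs))
  set β : ℝ := max (s - ε) 1
  have hβ : 1 ≤ β := le_max_right _ _
  have hτ' : (0 : ℝ) < τ := by exact_mod_cast hτ
  have hβp : 0 < β ^ p := by positivity
  -- Chosen so that 2^(δτ) = β^p; then δ < 1 is the inequality β^p < 2^τ.
  set δ := Real.logb 2 (β ^ p) / τ with hδ
  have hδ0 : 0 ≤ δ := div_nonneg (Real.logb_nonneg (by norm_num) (one_le_pow₀ hβ)) hτ'.le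
  have hδ1 : δ < 1 := by
    rw [hδ, div_lt_one hτ', Real.logb_lt_iff_lt_rpow (by norm_num) hβp]
    exact_mod_cast hlt
  obtain ⟨k, hk⟩ := hSETH δ hδ1
  refine hk (hproj.projectiveWith.solvableInTime_kSat num ψ hloop huv hβ
    (fun n => pow_le_pow_left₀ hpos.le (le_max_left _ _) n) hτ hle hδ0 ?_ hsol k)
  rw [hδ, div_mul_cancel₀ _ hτ'.ne', Real.rpow_logb (by norm_num) (by norm_num) hβp]
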